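/- Let $m,n\ge 1$, identify $\mathbb T^m$ with the periodic cube $[0,2\pi]^m$, and for a function $f$ on $\mathbb T^m\times\mathbb R^n$ put $$\hat f(k,\xi)=\frac1{(2\pi)^{m+n}}\int_{\mathbb T^m\times\mathbb R^n} f(x,y)e^{-i(k\cdot x+\xi\cdot y)}\,dx\,dy,\qquad k\in\mathbb Z^m,\ \xi\in\mathbb R^n.$$ The Fourier multiplier operator with symbol $M(k,\xi)$ is $f\mapsto\sum_{k\in\mathbb Z^m}\int_{\mathbb R^n}M(k,\xi)\hat f(k,\xi)e^{i(k\cdot x+\xi\cdot y)}\,d\xi$. Let $e^{it\Delta}$ and $(1-\Delta)^{\alpha/2}$ be the operators with symbols $e^{-it(|k|^2+|\xi|^2)}$ and $(1+|k|^2+|\xi|^2)^{\alpha/2}$, and let $\|f\|_{W^{\alpha,p}}=\|(1-\Delta)^{\alpha/2}f\|_{L^p(\mathbb T^m\times\mathbb R^n)}$. Let $\sigma_0\in C_c^\infty(\mathbb R^{m+n})$ be non-negative with $\operatorname{supp}\sigma_0\subset[-\frac34,\frac34)^{m+n}$ and $\sum_{K\in\mathbb Z^{m+n}}\sigma_0(\cdot-K)=1$,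 let $\square_K$ be the operator with symbol $\sigma_K=\sigma_0(\cdot-K)$ (restricted to $\mathbb Z^m\times\mathbb R^n$), let $\langle K\rangle=(1+|K|^2)^{1/2}$ and $$\|f\|_{M^\alpha_{p,q}}=\Big(\sum_{K\in\mathbb Z^{m+n}}\langle K\rangle^{q\alpha}\|\square_Kf\|_{L^p(\mathbb T^m\times\mathbb R^n)}^q\Big)^{1/q}$$ (the supremum of $\langle K\rangle^{\alpha}\|\square_Kf\|_{L^p}$ over $K$ if $q=\infty$). The Schwartz class of $\mathbb T^m\times\mathbb R^n$ consists of the smooth functions, $2\pi$-periodic in each $x_i$, all of whose derivatives decay rapidly in $y$. Below $1/\infty=0$. (i) Let $1\le p,q,r\le\infty$ and $\alpha\ge0$, and suppose there is a constant $C$ such that $$\big\|e^{it\Delta}f\big\|_{L^q(\mathbb T^m\times\mathbb R^n,\,L^r_t[0,1])}\le C\|f\|_{W^{\alpha,p}(\mathbb T^m\times\mathbb R^n)}$$ for all Schwartz functions $f$ on $\mathbb T^m\times\mathbb R^n$. Then $$\alpha\ge(m+n)\Big(\frac12-\frac1q\Big)+n\Big(\frac12-\frac1p\Big)-\frac2r.$$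 In particular, if $p=q=r$ then $\alpha\ge(m+2n)(\frac12-\frac1p)-\frac2p$; and if $p=2$ and $q=r$ then $\alpha\ge(m+n)(\frac12-\frac1q)-\frac2q$. (ii) Let $1\le p,q\le\infty$ and $\alpha\in\mathbb R$, and suppose there is a constant $C$ such that $$\big\|e^{it\Delta}f\big\|_{L^p(\mathbb T^m\times\mathbb R^n\times[0,1])}\le C\|f\|_{M^\alpha_{p,q}(\mathbb T^m\times\mathbb R^n)}$$ for all Schwartz functions $f$ on $\mathbb T^m\times\mathbb R^n$. Then $$\alpha\ge\max\Big\{0,\ (m+n)\Big(1-\frac1p-\frac1q\Big)-\frac2p\Big\}.$$ -/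

import Mathlib

open MeasureTheory
open scoped ENNReal NNReal

/-- Coordinates `(x, y)` for `𝕋^m × ℝ^n`. The torus `𝕋^m` is identified with the periodic cube
`[0, 2π]^m`: a function on `𝕋^m × ℝ^n` is a function of `(x, y) ∈ ℝ^m × ℝ^n` that is
`2π`-periodic in every coordinate of `x`. -/
abbrev Cyl (m n : ℕ) : Type := (Fin m → ℝ) × (Fin n → ℝ)

/-- The measure `dx dy` on `[0, 2π]^m × ℝ^n`. -/
noncomputable def cylMeasure (m n : ℕ) : Measure (Cyl m n) :=
  ((volume : Measure (Fin m → ℝ)).restrict (Set.Icc 0 (fun _ => 2 * Real.pi))).prod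
    (volume : Measure (Fin n → ℝ))

/-- Lebesgue measure on the time interval `[0, 1]`. -/
noncomputable def timeMeasure : Measure ℝ := volume.restrict (Set.Icc 0 1)

/-- The Schwartz class of `𝕋^m × ℝ^n`: smooth functions, `2π`-periodic in each `x_i`, all of
whose derivatives decay rapidly in `y`. -/
structure IsCylSchwartz {m n : ℕ} (f : Cyl m n → ℂ) : Prop where
  smooth : ContDiff ℝ ((⊤ : ℕ∞) : WithTop ℕ∞) f
  periodic : ∀ (k : Fin m → ℤ) (x : Fin m → ℝ) (y : Fin n → ℝ),
    f (fun i => x i + 2 * Real.pi * (k i : ℝ), y) = f (x, y)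
  decay : ∀ N j : ℕ, ∃ C : ℝ, ∀ z : Cyl m n, ‖z.2‖ ^ N * ‖iteratedFDeriv ℝ j f z‖ ≤ C

/-- The phase `k · x + ξ · y`. -/
def cylPhase {m n : ℕ} (k : Fin m → ℤ) (ξ : Fin n → ℝ) (z : Cyl m n) : ℝ :=
  (∑ i, (k i : ℝ) * z.1 i) + ∑ j, ξ j * z.2 j

/-- `|k|² + |ξ|²`, with Euclidean norms; this is the symbol of `-Δ`. -/
def freqSq {m n : ℕ} (k : Fin m → ℤ) (ξ : Fin n → ℝ) : ℝ :=
  (∑ i, (k i : ℝ) ^ 2) + ∑ j, ξ j ^ 2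

/-- `f̂(k, ξ) = (2π)^{-(m+n)} ∫ f(x, y) e^{-i(k·x + ξ·y)} dx dy`. -/
noncomputable def cylFourier {m n : ℕ} (f : Cyl m n → ℂ) (k : Fin m → ℤ) (ξ : Fin n → ℝ) : ℂ :=
  (((2 * Real.pi) ^ (m + n) : ℝ) : ℂ)⁻¹ *
    ∫ z, f z * Complex.exp (-(Complex.I * (cylPhase k ξ z : ℂ))) ∂(cylMeasure m n)

/-- The Fourier multiplier operator with symbol `M`:
`∑_{k ∈ ℤ^m} ∫_{ℝ^n} M(k, ξ) f̂(k, ξ) e^{i(k·x + ξ·y)} dξ`. -/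
noncomputable def cylMultiplier {m n : ℕ} (M : (Fin m → ℤ) → (Fin n → ℝ) → ℂ)
    (f : Cyl m n → ℂ) (z : Cyl m n) : ℂ :=
  ∑' k : Fin m → ℤ, ∫ ξ : Fin n → ℝ,
    M k ξ * cylFourier f k ξ * Complex.exp (Complex.I * (cylPhase k ξ z : ℂ))

/-- The Schrödinger propagator `e^{itΔ}`. -/
noncomputable def schrodinger {m n : ℕ} (t : ℝ) (f : Cyl m n → ℂ) : Cyl m n → ℂ :=
  cylMultiplier (fun k ξ => Complex.exp (-(Complex.I * (t : ℂ) * (freqSq k ξ : ℂ)))) f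

/-- The Bessel potential `(1 - Δ)^{α/2}`. -/
noncomputable def besselPotential {m n : ℕ} (α : ℝ) (f : Cyl m n → ℂ) : Cyl m n → ℂ :=
  cylMultiplier (fun k ξ => (((1 + freqSq k ξ) ^ (α / 2) : ℝ) : ℂ)) f

/-- `‖f‖_{W^{α,p}} = ‖(1 - Δ)^{α/2} f‖_{L^p}`. -/
noncomputable def sobolevNorm {m n : ℕ} (α : ℝ) (p : ℝ≥0∞) (f : Cyl m n → ℂ) : ℝ≥0∞ :=
  eLpNorm (besselPotential α f) p (cylMeasure m n)

/-- `‖e^{itΔ} f‖_{L^q(𝕋^m × ℝ^n, L^r[0,1])}`: the inner norm is in `t`, the outer one in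
`(x, y)`. -/
noncomputable def mixedNorm {m n : ℕ} (q r : ℝ≥0∞) (f : Cyl m n → ℂ) : ℝ≥0∞ :=
  eLpNorm (fun z : Cyl m n => eLpNorm (fun t : ℝ => schrodinger t f z) r timeMeasure) q
    (cylMeasure m n)

/-- `‖e^{itΔ} f‖_{L^p(𝕋^m × ℝ^n × [0,1])}`. -/
noncomputable def spaceTimeNorm {m n : ℕ} (p : ℝ≥0∞) (f : Cyl m n → ℂ) : ℝ≥0∞ :=
  eLpNorm (fun w : Cyl m n × ℝ => schrodinger w.2 f w.1) p ((cylMeasure m n).prod timeMeasure)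

/-- The translate `σ_K = σ_0(· - K)`, for `K ∈ ℤ^m × ℤ^n`. -/
def latticeTranslate {m n : ℕ} (σ : Cyl m n → ℝ) (K : (Fin m → ℤ) × (Fin n → ℤ))
    (z : Cyl m n) : ℝ :=
  σ (fun i => z.1 i - (K.1 i : ℝ), fun j => z.2 j - (K.2 j : ℝ))

/-- `σ = σ_0` generates a smooth partition of unity `(σ_K)_K` of the frequency space `ℝ^{m+n}`
adapted to the unit cubes `K + [-1/2, 1/2)^{m+n}`, with `supp σ_0 ⊆ [-3/4, 3/4)^{m+n}`. -/
structure IsUnitCubePartition {m n : ℕ} (σ : Cyl m n → ℝ) : Prop where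
  smooth : ContDiff ℝ ((⊤ : ℕ∞) : WithTop ℕ∞) σ
  nonneg : ∀ z, 0 ≤ σ z
  support : tsupport σ ⊆ {z : Cyl m n | (∀ i, z.1 i ∈ Set.Ico (-(3 / 4) : ℝ) (3 / 4)) ∧
    ∀ j, z.2 j ∈ Set.Ico (-(3 / 4) : ℝ) (3 / 4)}
  sum_eq_one : ∀ z, HasSum (fun K => latticeTranslate σ K z) 1

/-- `□_K f`, the Fourier multiplier with symbol `σ_K`. -/
noncomputable def boxOp {m n : ℕ} (σ : Cyl m n → ℝ) (K : (Fin m → ℤ) × (Fin n → ℤ))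
    (f : Cyl m n → ℂ) : Cyl m n → ℂ :=
  cylMultiplier (fun k ξ => (latticeTranslate σ K (fun i => (k i : ℝ), ξ) : ℂ)) f

/-- `⟨K⟩ = (1 + |K|²)^{1/2}`. -/
noncomputable def japanese {m n : ℕ} (K : (Fin m → ℤ) × (Fin n → ℤ)) : ℝ :=
  Real.sqrt (1 + freqSq K.1 (fun j => (K.2 j : ℝ)))

/-- `‖f‖_{M^α_{p,q}}`: the `ℓ^q(ℤ^{m+n})` norm of `K ↦ ⟨K⟩^α ‖□_K f‖_{L^p}`, which is
`(∑_K ⟨K⟩^{qα} ‖□_K f‖_{L^p}^q)^{1/q}` for `q < ∞` and the supremum for `q = ∞`. -/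
noncomputable def modulationNorm {m n : ℕ} (σ : Cyl m n → ℝ) (α : ℝ) (p q : ℝ≥0∞)
    (f : Cyl m n → ℂ) : ℝ≥0∞ :=
  eLpNorm (fun K : (Fin m → ℤ) × (Fin n → ℤ) =>
    ENNReal.ofReal (japanese K ^ α) * eLpNorm (boxOp σ K f) p (cylMeasure m n)) q Measure.count

/-! Each necessary condition comes from testing the inequality on a family of data with a large
parameter and comparing powers of it (`le_of_eventually_mul_rpow_le`). The data are finite sums over
torus frequencies with Schwartz profiles in `ξ` (`waveSum`), so every multiplier is a finite sum of
integrals. Exponents `1/p` appear as `(p⁻¹).toReal`, which is `0` at `p = ∞`.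

Modulation spaces. A single frequency bump at a lattice point `K` gives a solution bounded below,
uniformly in `K`, on a fixed set, while its modulation norm is at most a constant times `⟨K⟩^α`;
hence `α ≥ 0`. For the second condition, place a bump at each point of `{0, …, N-1}^(m+n)`. With `D
= m + n`, the phases are coherent for `|x|, |y| ≲ 1/N` and `0 ≤ t ≲ 1/N²`, so the solution has size
`N^D` on a set of measure about `N^(-(D+2))`. Each box operator sees at most one bump, so the
modulation norm is `≲ N^(α + D/q)`.

Sobolev spaces. The data are `(1-Δ)^(-α/2) e^(-it₀Δ)` applied to an approximate delta function at
frequency scale `N`: the sharp cube `{0, …, N-1}^m` on the torus and the Gaussian `e^(-|ξ|²/N²)` on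
`ℝⁿ`. At time `t₀` the solution focuses and has size `N^(D-α)` for `|x|, |y| ≲ 1/N` and `0 ≤ t - t₀
≲ 1/N²` (`exists_le_norm_schrodinger_focusWave`). At time `0` it is dispersed: with `t₀ = πa/N` and
`a` coprime to `N`, the torus factor is a product of `m` quadratic Weyl sums, each `≲ (N log
N)^(1/2)` (`norm_sq_quadratic_sum_le`), and the Euclidean factor is a Gaussian of bounded height and
width `N`. Thus the Sobolev norm is `≲ N^(m/2 + n/p)` up to a power of `log N`, which is absorbed
into an arbitrarily small power of `N`. Comparison gives `D - α - 2/r - D/q ≤ m/2 + n/p`, which is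
the claim. -/

open scoped SchwartzMap FourierTransform

/-! ### Fourier inversion and finite sums of waves on the cylinder -/

/-- The inverse Fourier transform `y ↦ ∫ G(ξ) e^{iξ·y} dξ` on `ℝⁿ`, as a Schwartz function. -/
noncomputable def invFourier {n : ℕ} (G : 𝓢(Fin n → ℝ, ℂ)) : 𝓢(Fin n → ℝ, ℂ) :=
  SchwartzMap.compCLMOfContinuousLinearEquiv ℂ
    ((EuclideanSpace.equiv (Fin n) ℝ).symm.trans
      (ContinuousLinearEquiv.smulLeft (Units.mk0 ((2 * Real.pi)⁻¹ : ℝ) (by positivity))))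
    (𝓕⁻ (SchwartzMap.compCLMOfContinuousLinearEquiv ℂ (EuclideanSpace.equiv (Fin n) ℝ) G))

theorem invFourier_apply {n : ℕ} (G : 𝓢(Fin n → ℝ, ℂ)) (y : Fin n → ℝ) :
    invFourier G y = ∫ ξ, G ξ * Complex.exp (Complex.I * ((∑ j, ξ j * y j : ℝ) : ℂ)) := by
  rw [invFourier, SchwartzMap.compCLMOfContinuousLinearEquiv_apply, SchwartzMap.fourierInv_coe,
    Function.comp_apply, Real.fourierInv_eq',
    ← (PiLp.volume_preserving_toLp (Fin n)).integral_comp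
      (MeasurableEquiv.toLp 2 _).measurableEmbedding]
  refine integral_congr_ae (Filter.Eventually.of_forall fun ξ => ?_)
  simp only [smul_eq_mul, SchwartzMap.compCLMOfContinuousLinearEquiv_apply, Function.comp_apply]
  rw [mul_comm]
  congr 2
  have : (2 * Real.pi * inner ℝ (WithLp.toLp 2 ξ)
      (((EuclideanSpace.equiv (Fin n) ℝ).symm.trans
      (ContinuousLinearEquiv.smulLeft (Units.mk0 ((2 * Real.pi)⁻¹ : ℝ) (by positivity)))) y))
      = ∑ j, ξ j * y j := by
    have : (((EuclideanSpace.equiv (Fin n) ℝ).symm.trans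
      (ContinuousLinearEquiv.smulLeft (Units.mk0 ((2 * Real.pi)⁻¹ : ℝ) (by positivity)))) y)
      = (2 * Real.pi)⁻¹ • WithLp.toLp 2 y := rfl
    rw [this, inner_smul_right, ← mul_assoc, mul_inv_cancel₀ (by positivity), one_mul]
    simp [PiLp.inner_apply, mul_comm]
  rw [this, mul_comm]

/-- Fourier inversion in the normalization `e^{2πi⟨ξ, y⟩}`, after the dilation `y ↦ y / 2π`; the
Jacobian of the dilation is the factor `(2π)^n`. -/
theorem integral_invFourier {n : ℕ} (G : 𝓢(Fin n → ℝ, ℂ)) (ξ : Fin n → ℝ) :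
    ∫ y, invFourier G y * Complex.exp (-(Complex.I * ((∑ j, ξ j * y j : ℝ) : ℂ)))
      = (((2 * Real.pi) ^ n : ℝ) : ℂ) * G ξ := by
  set H := SchwartzMap.compCLMOfContinuousLinearEquiv ℂ (EuclideanSpace.equiv (Fin n) ℝ) G
  have hG : G ξ = 𝓕 (𝓕⁻ H) (WithLp.toLp 2 ξ) := by
    rw [FourierTransform.fourier_fourierInv_eq]; rfl
  have hscale := Measure.integral_comp_inv_smul (volume : Measure (Fin n → ℝ))
    (fun y => (𝓕⁻ H) (WithLp.toLp 2 y) *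
      Complex.exp (-(Complex.I * ((2 * Real.pi * ∑ j, ξ j * y j : ℝ) : ℂ)))) (2 * Real.pi)
  rw [Module.finrank_fin_fun, abs_of_nonneg (by positivity)] at hscale
  rw [hG, SchwartzMap.fourier_coe, Real.fourier_eq',
    ← (PiLp.volume_preserving_toLp (Fin n)).integral_comp
      (MeasurableEquiv.toLp 2 _).measurableEmbedding]
  rw [← Complex.real_smul]
  convert hscale using 1
  · refine integral_congr_ae (Filter.Eventually.of_forall fun y => ?_)
    have h1 : invFourier G y = (𝓕⁻ H) (WithLp.toLp 2 ((2 * Real.pi)⁻¹ • y)) := rfl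
    have h2 : ∑ j, ξ j * y j = 2 * Real.pi * ∑ j, ξ j * ((2 * Real.pi)⁻¹ • y) j := by
      simp only [Pi.smul_apply, smul_eq_mul, Finset.mul_sum]
      refine Finset.sum_congr rfl fun j _ => ?_
      field_simp
    simp only [h1, h2]
  · congr 1
    refine integral_congr_ae (Filter.Eventually.of_forall fun y => ?_)
    simp only [smul_eq_mul]
    rw [mul_comm]
    congr 2
    have : inner ℝ (WithLp.toLp 2 y) (WithLp.toLp 2 ξ) = ∑ j, ξ j * y j := by
      simp [PiLp.inner_apply]
    rw [this]
    push_cast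
    ring

/-- The character `e^{ik·x}` of the torus, as a function on the cylinder. -/
noncomputable def torusChar {m n : ℕ} (k : Fin m → ℤ) (z : Cyl m n) : ℂ :=
  Complex.exp (Complex.I * ((∑ i, (k i : ℝ) * z.1 i : ℝ) : ℂ))

theorem exp_cylPhase {m n : ℕ} (k : Fin m → ℤ) (ξ : Fin n → ℝ) (z : Cyl m n) :
    Complex.exp (Complex.I * (cylPhase k ξ z : ℂ)) =
      torusChar k z * Complex.exp (Complex.I * ((∑ j, ξ j * z.2 j : ℝ) : ℂ)) := by
  rw [cylPhase, torusChar, ← Complex.exp_add]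
  push_cast
  ring_nf

theorem iteratedFDeriv_exp_I_bound (j : ℕ) (s : ℝ) :
    ‖iteratedFDeriv ℝ j (fun s : ℝ => Complex.exp (Complex.I * (s : ℂ))) s‖ ≤ 1 := by
  rw [norm_iteratedFDeriv_eq_norm_iteratedDeriv]
  have h : ∀ j : ℕ, iteratedDeriv j (fun s : ℝ => Complex.exp (Complex.I * (s : ℂ))) =
      fun s : ℝ => Complex.I ^ j * Complex.exp (Complex.I * (s : ℂ)) := by
    intro j
    induction j with
    | zero => simp
    | succ j ih =>
      rw [iteratedDeriv_succ, ih]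
      funext s
      have h1 : HasDerivAt (fun s : ℝ => Complex.I * (s : ℂ)) (Complex.I * 1) s :=
        (Complex.ofRealCLM.hasDerivAt (x := s)).const_mul _
      rw [(h1.cexp.const_mul _).deriv]
      ring
  rw [h]
  change ‖Complex.I ^ j * Complex.exp (Complex.I * (s : ℂ))‖ ≤ 1
  rw [mul_comm Complex.I (s : ℂ), norm_mul, Complex.norm_exp_ofReal_mul_I]
  simp

/-- The linear form `(x, y) ↦ k · x`. -/
noncomputable def torusForm {m n : ℕ} (k : Fin m → ℤ) : Cyl m n →L[ℝ] ℝ :=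
  ∑ i, (k i : ℝ) • ((ContinuousLinearMap.proj i).comp (ContinuousLinearMap.fst ℝ _ _))

theorem torusForm_apply {m n : ℕ} (k : Fin m → ℤ) (z : Cyl m n) :
    torusForm k z = ∑ i, (k i : ℝ) * z.1 i := by
  simp [torusForm]

theorem torusChar_eq_comp {m n : ℕ} (k : Fin m → ℤ) :
    (torusChar k : Cyl m n → ℂ) =
      (fun s : ℝ => Complex.exp (Complex.I * (s : ℂ))) ∘ torusForm k := by
  funext z
  simp only [torusChar, Function.comp_apply, torusForm_apply]

theorem contDiff_exp_I {N : WithTop ℕ∞} :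
    ContDiff ℝ N (fun s : ℝ => Complex.exp (Complex.I * (s : ℂ))) :=
  (contDiff_const.mul Complex.ofRealCLM.contDiff).cexp

theorem contDiff_torusChar {m n : ℕ} (k : Fin m → ℤ) {N : WithTop ℕ∞} :
    ContDiff ℝ N (torusChar k : Cyl m n → ℂ) := by
  rw [torusChar_eq_comp]
  exact contDiff_exp_I.comp (torusForm k).contDiff

theorem norm_iteratedFDeriv_torusChar_le {m n : ℕ} (k : Fin m → ℤ) (j : ℕ) (z : Cyl m n) :
    ‖iteratedFDeriv ℝ j (torusChar k : Cyl m n → ℂ) z‖ ≤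
      ‖iteratedFDeriv ℝ j (fun s : ℝ => Complex.exp (Complex.I * (s : ℂ))) (torusForm k z)‖ *
        ‖(torusForm k : Cyl m n →L[ℝ] ℝ)‖ ^ j := by
  rw [torusChar_eq_comp,
    (torusForm k).iteratedFDeriv_comp_right contDiff_exp_I z (i := j) (n := j) le_rfl]
  refine (ContinuousMultilinearMap.norm_compContinuousLinearMap_le _ _).trans ?_
  simp

/-- Every derivative of a character is bounded, so in the Leibniz formula all the decay in `y` can
be taken from `g`. -/
theorem isCylSchwartz_torusChar_mul {m n : ℕ} (k : Fin m → ℤ) (g : 𝓢(Fin n → ℝ, ℂ)) :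
    IsCylSchwartz (fun z : Cyl m n => torusChar k z * g z.2) := by
  have hg : ContDiff ℝ ((⊤ : ℕ∞) : WithTop ℕ∞) (fun z : Cyl m n => g z.2) :=
    g.smooth'.comp contDiff_snd
  refine ⟨(contDiff_torusChar k).mul hg, fun l x y => ?_, fun N j => ?_⟩
  · simp only [torusChar]
    congr 1
    have : Complex.I * ((∑ i, (k i : ℝ) * (x i + 2 * Real.pi * (l i : ℝ)) : ℝ) : ℂ) =
        Complex.I * ((∑ i, (k i : ℝ) * x i : ℝ) : ℂ) +
          ((∑ i, k i * l i : ℤ) : ℂ) * (2 * Real.pi * Complex.I) := by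
      simp only [mul_add, Finset.sum_add_distrib]
      push_cast
      simp only [mul_add, Finset.sum_mul, Finset.mul_sum]
      congr 1
      exact Finset.sum_congr rfl fun i _ => by ring
    rw [this, Complex.exp_add, Complex.exp_int_mul_two_pi_mul_I, mul_one]
  · have hdec : ∀ l : ℕ, ∃ C : ℝ, ∀ z : Cyl m n,
        ‖z.2‖ ^ N * ‖iteratedFDeriv ℝ l (fun z : Cyl m n => g z.2) z‖ ≤ C := by
      intro l
      obtain ⟨C, hC⟩ := g.decay' N l
      refine ⟨C * ‖ContinuousLinearMap.snd ℝ (Fin m → ℝ) (Fin n → ℝ)‖ ^ l, fun z => ?_⟩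
      have h := (ContinuousLinearMap.snd ℝ (Fin m → ℝ) (Fin n → ℝ)).iteratedFDeriv_comp_right
        g.smooth' z (i := l) (by exact_mod_cast le_top)
      have h' : ‖iteratedFDeriv ℝ l (fun z : Cyl m n => g z.2) z‖ ≤
          ‖iteratedFDeriv ℝ l g z.2‖ *
            ‖ContinuousLinearMap.snd ℝ (Fin m → ℝ) (Fin n → ℝ)‖ ^ l := by
        change ‖iteratedFDeriv ℝ l (g ∘ (ContinuousLinearMap.snd ℝ (Fin m → ℝ) (Fin n → ℝ))) z‖ ≤ _
        erw [h]
        refine (ContinuousMultilinearMap.norm_compContinuousLinearMap_le _ _).trans ?_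
        simp only [Finset.prod_const, Finset.card_univ, Fintype.card_fin]
        exact le_rfl
      calc _ ≤ ‖z.2‖ ^ N * (‖iteratedFDeriv ℝ l g z.2‖ *
            ‖ContinuousLinearMap.snd ℝ (Fin m → ℝ) (Fin n → ℝ)‖ ^ l) := by gcongr
        _ = (‖z.2‖ ^ N * ‖iteratedFDeriv ℝ l g z.2‖) *
            ‖ContinuousLinearMap.snd ℝ (Fin m → ℝ) (Fin n → ℝ)‖ ^ l := by ring
        _ ≤ _ := by gcongr; exact hC z.2
    choose C hC using hdec
    refine ⟨∑ i ∈ Finset.range (j + 1), (j.choose i : ℝ) *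
      ‖(torusForm k : Cyl m n →L[ℝ] ℝ)‖ ^ i * C (j - i), fun z => ?_⟩
    calc _ ≤ ‖z.2‖ ^ N * ∑ i ∈ Finset.range (j + 1), (j.choose i : ℝ) *
          ‖iteratedFDeriv ℝ i (torusChar k : Cyl m n → ℂ) z‖ *
          ‖iteratedFDeriv ℝ (j - i) (fun z : Cyl m n => g z.2) z‖ := by
          gcongr
          exact norm_iteratedFDeriv_mul_le (contDiff_torusChar k (N := ((⊤ : ℕ∞) : WithTop ℕ∞)))
            hg z (by exact_mod_cast le_top)
      _ ≤ _ := by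
          rw [Finset.mul_sum]
          refine Finset.sum_le_sum fun i _ => ?_
          calc _ = (j.choose i : ℝ) * ‖iteratedFDeriv ℝ i (torusChar k : Cyl m n → ℂ) z‖ *
                (‖z.2‖ ^ N * ‖iteratedFDeriv ℝ (j - i) (fun z : Cyl m n => g z.2) z‖) := by ring
            _ ≤ _ := by
              gcongr
              · refine (norm_iteratedFDeriv_torusChar_le k i z).trans ?_
                exact mul_le_of_le_one_left (by positivity) (iteratedFDeriv_exp_I_bound _ _)
              · exact hC _ z

theorem IsCylSchwartz.sum {ι : Type*} {m n : ℕ} (S : Finset ι) {f : ι → Cyl m n → ℂ}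
    (hf : ∀ k, IsCylSchwartz (f k)) : IsCylSchwartz (fun z => ∑ k ∈ S, f k z) := by
  refine ⟨ContDiff.sum fun k _ => (hf k).smooth, fun l x y => ?_, fun N j => ?_⟩
  · exact Finset.sum_congr rfl fun k _ => (hf k).periodic l x y
  · choose C hC using fun k => (hf k).decay N j
    refine ⟨∑ k ∈ S, C k, fun z => ?_⟩
    have := iteratedFDeriv_sum (𝕜 := ℝ) (i := j) (f := f) (u := S)
      (fun k _ => ((hf k).smooth.of_le (by exact_mod_cast le_top)))
    rw [this]
    calc _ ≤ ‖z.2‖ ^ N * ∑ k ∈ S, ‖iteratedFDeriv ℝ j (f k) z‖ := by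
          gcongr
          rw [Finset.sum_apply]
          exact norm_sum_le _ _
      _ ≤ _ := by
          rw [Finset.mul_sum]
          exact Finset.sum_le_sum fun k _ => hC k z

/-- The function on the cylinder whose Fourier transform is `G k` at the frequencies `k ∈ S`
and vanishes at the other ones. -/
noncomputable def waveSum {m n : ℕ} (S : Finset (Fin m → ℤ))
    (G : (Fin m → ℤ) → 𝓢(Fin n → ℝ, ℂ)) (z : Cyl m n) : ℂ :=
  ∑ k ∈ S, torusChar k z * invFourier (G k) z.2

theorem isCylSchwartz_waveSum {m n : ℕ} (S : Finset (Fin m → ℤ))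
    (G : (Fin m → ℤ) → 𝓢(Fin n → ℝ, ℂ)) : IsCylSchwartz (waveSum S G : Cyl m n → ℂ) :=
  IsCylSchwartz.sum S fun k => isCylSchwartz_torusChar_mul k (invFourier (G k))

theorem integral_exp_int_period (l : ℤ) :
    ∫ x in Set.Icc (0 : ℝ) (2 * Real.pi), Complex.exp (Complex.I * ((l : ℝ) * x : ℝ)) =
      if l = 0 then ((2 * Real.pi : ℝ) : ℂ) else 0 := by
  rw [integral_Icc_eq_integral_Ioc, ← intervalIntegral.integral_of_le (by positivity)]
  split_ifs with h
  · simp [h]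
  · have hc : Complex.I * (l : ℂ) ≠ 0 := mul_ne_zero Complex.I_ne_zero (by exact_mod_cast h)
    have := integral_exp_mul_complex (a := 0) (b := 2 * Real.pi) hc
    have h2 : ∀ x : ℝ, Complex.I * (((l : ℝ) * x : ℝ) : ℂ) = Complex.I * (l : ℂ) * x := by
      intro x; push_cast; ring
    simp only [h2, this]
    have h3 : Complex.I * (l : ℂ) * ((2 * Real.pi : ℝ) : ℂ) = (l : ℂ) * (2 * Real.pi * Complex.I) := by
      push_cast; ring
    rw [h3, Complex.exp_int_mul_two_pi_mul_I]
    simp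

theorem volume_restrict_cube (m : ℕ) (a b : Fin m → ℝ) :
    (volume : Measure (Fin m → ℝ)).restrict (Set.Icc a b) =
      Measure.pi fun i => (volume : Measure ℝ).restrict (Set.Icc (a i) (b i)) := by
  rw [← Set.pi_univ_Icc, volume_pi, Measure.restrict_pi_pi]

theorem integral_torusChar_cube {m : ℕ} (k : Fin m → ℤ) :
    ∫ x in Set.Icc (0 : Fin m → ℝ) (fun _ => 2 * Real.pi),
        Complex.exp (Complex.I * ((∑ i, (k i : ℝ) * x i : ℝ) : ℂ)) =
      if k = 0 then (((2 * Real.pi) ^ m : ℝ) : ℂ) else 0 := by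
  have h : ∀ x : Fin m → ℝ, Complex.exp (Complex.I * ((∑ i, (k i : ℝ) * x i : ℝ) : ℂ)) =
      ∏ i, Complex.exp (Complex.I * (((k i : ℝ) * x i : ℝ) : ℂ)) := by
    intro x
    rw [← Complex.exp_sum, Complex.ofReal_sum, Finset.mul_sum]
  simp only [h]
  rw [volume_restrict_cube, integral_fintype_prod_eq_prod
    (fun i (x : ℝ) => Complex.exp (Complex.I * (((k i : ℝ) * x : ℝ) : ℂ)))]
  simp only [Pi.zero_apply, integral_exp_int_period]
  split_ifs with hk
  · simp [hk]
  · obtain ⟨i, hi⟩ := Function.ne_iff.mp hk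
    exact Finset.prod_eq_zero (Finset.mem_univ i) (by simpa using hi)

theorem SchwartzMap.integrable_mul_exp_I {n : ℕ} (g : 𝓢(Fin n → ℝ, ℂ)) {θ : (Fin n → ℝ) → ℝ}
    (hθ : Continuous θ) :
    Integrable (fun y => g y * Complex.exp (Complex.I * (θ y : ℂ))) := by
  refine (g.integrable (μ := volume)).mul_bdd (c := 1) ?_ ?_
  · exact (by fun_prop : Continuous fun y => Complex.exp (Complex.I * (θ y : ℂ))).aestronglyMeasurable
  · refine Filter.Eventually.of_forall fun y => ?_
    rw [mul_comm, Complex.norm_exp_ofReal_mul_I]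

/-- Orthogonality of the characters on the cube isolates the term `k`, and inversion on `ℝⁿ`
recovers its profile; the powers of `2π` cancel the normalization of `cylFourier`. -/
theorem cylFourier_waveSum {m n : ℕ} (S : Finset (Fin m → ℤ))
    (G : (Fin m → ℤ) → 𝓢(Fin n → ℝ, ℂ)) (k : Fin m → ℤ) (ξ : Fin n → ℝ) :
    cylFourier (waveSum S G) k ξ = if k ∈ S then G k ξ else 0 := by
  have hterm : ∀ (l : Fin m → ℤ) (z : Cyl m n),
      torusChar l z * invFourier (G l) z.2 * Complex.exp (-(Complex.I * (cylPhase k ξ z : ℂ))) =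
        Complex.exp (Complex.I * ((∑ i, (((l - k) i : ℤ) : ℝ) * z.1 i : ℝ) : ℂ)) *
          (invFourier (G l) z.2 *
            Complex.exp (-(Complex.I * ((∑ j, ξ j * z.2 j : ℝ) : ℂ)))) := by
    intro l z
    have : torusChar l z * Complex.exp (-(Complex.I * (cylPhase k ξ z : ℂ))) =
        Complex.exp (Complex.I * ((∑ i, (((l - k) i : ℤ) : ℝ) * z.1 i : ℝ) : ℂ)) *
          Complex.exp (-(Complex.I * ((∑ j, ξ j * z.2 j : ℝ) : ℂ))) := by
      rw [torusChar, cylPhase, ← Complex.exp_add, ← Complex.exp_add]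
      congr 1
      push_cast [Pi.sub_apply]
      simp only [sub_mul, Finset.sum_sub_distrib]
      ring
    linear_combination invFourier (G l) z.2 * this
  have hint : ∀ l : Fin m → ℤ, Integrable (fun z : Cyl m n =>
      Complex.exp (Complex.I * ((∑ i, (((l - k) i : ℤ) : ℝ) * z.1 i : ℝ) : ℂ)) *
          (invFourier (G l) z.2 *
            Complex.exp (-(Complex.I * ((∑ j, ξ j * z.2 j : ℝ) : ℂ))))) (cylMeasure m n) := by
    intro l
    refine Integrable.mul_prod (f := fun x : Fin m → ℝ =>
      Complex.exp (Complex.I * ((∑ i, (((l - k) i : ℤ) : ℝ) * x i : ℝ) : ℂ)))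
      (g := fun y => invFourier (G l) y *
            Complex.exp (-(Complex.I * ((∑ j, ξ j * y j : ℝ) : ℂ)))) ?_ ?_
    · exact (Continuous.continuousOn (by fun_prop)).integrableOn_compact isCompact_Icc
    · have := (invFourier (G l)).integrable_mul_exp_I (θ := fun y => -∑ j, ξ j * y j)
        (by fun_prop)
      simpa using this
  have hval : ∀ l : Fin m → ℤ, ∫ z : Cyl m n,
      Complex.exp (Complex.I * ((∑ i, (((l - k) i : ℤ) : ℝ) * z.1 i : ℝ) : ℂ)) *
          (invFourier (G l) z.2 *
            Complex.exp (-(Complex.I * ((∑ j, ξ j * z.2 j : ℝ) : ℂ)))) ∂(cylMeasure m n) =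
        if l = k then (((2 * Real.pi) ^ (m + n) : ℝ) : ℂ) * G k ξ else 0 := by
    intro l
    rw [cylMeasure, integral_prod_mul (fun x : Fin m → ℝ =>
      Complex.exp (Complex.I * ((∑ i, (((l - k) i : ℤ) : ℝ) * x i : ℝ) : ℂ)))
      (fun y => invFourier (G l) y *
            Complex.exp (-(Complex.I * ((∑ j, ξ j * y j : ℝ) : ℂ)))), integral_torusChar_cube,
      integral_invFourier]
    simp only [sub_eq_zero]
    split_ifs with h
    · subst h; push_cast; ring
    · simp
  rw [cylFourier]
  simp only [waveSum, Finset.sum_mul, hterm]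
  rw [integral_finsetSum _ fun l _ => hint l]
  simp only [hval, Finset.sum_ite_eq']
  split_ifs with h
  · rw [← mul_assoc, inv_mul_cancel₀, one_mul]
    exact_mod_cast (by positivity : ((2 * Real.pi) ^ (m + n) : ℝ) ≠ 0)
  · simp

theorem cylMultiplier_waveSum {m n : ℕ} (M : (Fin m → ℤ) → (Fin n → ℝ) → ℂ)
    (S : Finset (Fin m → ℤ)) (G : (Fin m → ℤ) → 𝓢(Fin n → ℝ, ℂ)) (z : Cyl m n) :
    cylMultiplier M (waveSum S G) z = ∑ k ∈ S, ∫ ξ : Fin n → ℝ,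
      M k ξ * G k ξ * Complex.exp (Complex.I * (cylPhase k ξ z : ℂ)) := by
  rw [cylMultiplier, tsum_eq_sum (s := S)]
  · refine Finset.sum_congr rfl fun k hk => ?_
    simp only [cylFourier_waveSum, hk, if_true]
  · intro k hk
    simp [cylFourier_waveSum, hk]

/-! ### Lower bounds for norms and for non-oscillating sums -/

/-- Comparison with a constant times an indicator. The condition `μ s ≠ 0` is what keeps the bound
true for `p = ∞`, where the power of the measure is `1`. -/
theorem mul_measure_rpow_le_eLpNorm {X ε : Type*} [MeasurableSpace X] [ENorm ε] {μ : Measure X}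
    {f : X → ε} {p c : ℝ≥0∞} {s : Set X} (hs : MeasurableSet s) (hμs : μ s ≠ 0) (hp : 1 ≤ p)
    (hf : ∀ x ∈ s, c ≤ ‖f x‖ₑ) : c * μ s ^ (p⁻¹).toReal ≤ eLpNorm f p μ := by
  have h := eLpNorm_indicator_const' (c := c) hs hμs (zero_lt_one.trans_le hp).ne'
  rw [enorm_eq_self, one_div, ← ENNReal.toReal_inv] at h
  rw [← h]
  refine eLpNorm_mono_enorm fun x => ?_
  by_cases hx : x ∈ s
  · simpa [hx] using hf x hx
  · simp [hx]

theorem cylMeasure_cube (m n : ℕ) {ρ : ℝ} (hρ0 : 0 ≤ ρ) (hρ : ρ ≤ 2 * Real.pi) :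
    cylMeasure m n (Set.Icc (0 : Fin m → ℝ) (fun _ => ρ) ×ˢ Set.Icc (0 : Fin n → ℝ) (fun _ => ρ)) =
      ENNReal.ofReal (ρ ^ (m + n)) := by
  have h : Set.Icc (0 : Fin m → ℝ) (fun _ => ρ) ∩ Set.Icc 0 (fun _ => 2 * Real.pi) =
      Set.Icc 0 (fun _ => ρ) :=
    Set.inter_eq_left.mpr (Set.Icc_subset_Icc_right fun _ => hρ)
  rw [cylMeasure, Measure.prod_prod, Measure.restrict_apply measurableSet_Icc, h,
    Real.volume_Icc_pi, Real.volume_Icc_pi, pow_add, ENNReal.ofReal_mul (by positivity)]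
  simp [ENNReal.ofReal_pow hρ0]

theorem timeMeasure_Icc {a b : ℝ} (ha : 0 ≤ a) (hb : b ≤ 1) :
    timeMeasure (Set.Icc a b) = ENNReal.ofReal (b - a) := by
  rw [timeMeasure, Measure.restrict_apply measurableSet_Icc,
    Set.inter_eq_left.mpr (Set.Icc_subset_Icc ha hb), Real.volume_Icc]

theorem le_of_eventually_mul_rpow_le {u : ℕ → ℝ} (hu : Filter.Tendsto u Filter.atTop Filter.atTop)
    {c C a b : ℝ} (hc : 0 < c) (h : ∀ᶠ j in Filter.atTop, c * u j ^ a ≤ C * u j ^ b) : a ≤ b := by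
  by_contra! hab
  have h1 : Filter.Tendsto (fun j => c * u j ^ (a - b)) Filter.atTop Filter.atTop :=
    ((tendsto_rpow_atTop (sub_pos.mpr hab)).comp hu).const_mul_atTop hc
  obtain ⟨j, hj, hj1, hj2⟩ := (h.and ((h1.eventually_gt_atTop C).and
    (hu.eventually_gt_atTop 0))).exists
  rw [Real.rpow_sub hj2, ← mul_div_assoc, lt_div_iff₀ (Real.rpow_pos_of_pos hj2 _)] at hj1
  linarith

/-- Multiplying by the unimodular `e^{-iθ₀}` does not change the modulus, and a modulus dominates
the real part. The reference phase `θ₀` may depend on the point and the time. -/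
theorem sum_integral_mul_cos_le_norm {κ E : Type*} [MeasurableSpace E] [TopologicalSpace E]
    [OpensMeasurableSpace E] {μ : Measure E}
    (S : Finset κ) {w θ : κ → E → ℝ} (θ₀ : ℝ) (hw : ∀ k ∈ S, Integrable (w k) μ)
    (hθ : ∀ k ∈ S, Continuous (θ k)) :
    ∑ k ∈ S, ∫ ξ, w k ξ * Real.cos (θ k ξ - θ₀) ∂μ ≤
      ‖∑ k ∈ S, ∫ ξ, (w k ξ : ℂ) * Complex.exp (Complex.I * (θ k ξ : ℂ)) ∂μ‖ := by
  have hint : ∀ k ∈ S, Integrable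
      (fun ξ => (w k ξ : ℂ) * Complex.exp (Complex.I * ((θ k ξ - θ₀ : ℝ) : ℂ))) μ := by
    intro k hk
    have hθk := hθ k hk
    refine (hw k hk).ofReal.mul_bdd (c := 1) ?_ ?_
    · exact (by fun_prop : Continuous fun ξ =>
        Complex.exp (Complex.I * ((θ k ξ - θ₀ : ℝ) : ℂ))).aestronglyMeasurable
    · refine Filter.Eventually.of_forall fun y => ?_
      rw [mul_comm, Complex.norm_exp_ofReal_mul_I]
  have hrot : Complex.exp (((-θ₀ : ℝ) : ℂ) * Complex.I) *
      ∑ k ∈ S, ∫ ξ, (w k ξ : ℂ) * Complex.exp (Complex.I * (θ k ξ : ℂ)) ∂μ =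
      ∑ k ∈ S, ∫ ξ, (w k ξ : ℂ) * Complex.exp (Complex.I * ((θ k ξ - θ₀ : ℝ) : ℂ)) ∂μ := by
    rw [Finset.mul_sum]
    refine Finset.sum_congr rfl fun k _ => ?_
    rw [← integral_const_mul]
    congr 1; funext ξ
    rw [mul_left_comm, ← Complex.exp_add]
    push_cast
    ring_nf
  calc _ = (∑ k ∈ S, ∫ ξ, (w k ξ : ℂ) *
        Complex.exp (Complex.I * ((θ k ξ - θ₀ : ℝ) : ℂ)) ∂μ).re := by
        rw [Complex.re_sum]
        refine Finset.sum_congr rfl fun k hk => ?_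
        have := Complex.reCLM.integral_comp_comm (hint k hk)
        simp only [Complex.reCLM_apply] at this
        rw [← this]
        congr 1; funext ξ
        rw [Complex.re_ofReal_mul, mul_comm Complex.I, Complex.exp_ofReal_mul_I_re]
    _ ≤ _ := by
        rw [← hrot]
        refine (Complex.re_le_norm _).trans ?_
        rw [norm_mul, Complex.norm_exp_ofReal_mul_I, one_mul]

/-- Where the phase is within `1` of `θ₀`, the cosine is at least `1 - 1/2`, so there is no
cancellation. -/
theorem half_sum_integral_le_norm {κ E : Type*} [MeasurableSpace E] [TopologicalSpace E]
    [OpensMeasurableSpace E] {μ : Measure E}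
    (S : Finset κ) {w θ : κ → E → ℝ} (θ₀ : ℝ) (hw : ∀ k ∈ S, Integrable (w k) μ)
    (hθ : ∀ k ∈ S, Continuous (θ k)) (hw0 : ∀ k ξ, 0 ≤ w k ξ)
    (hosc : ∀ k ∈ S, ∀ ξ, w k ξ ≠ 0 → |θ k ξ - θ₀| ≤ 1) :
    (∑ k ∈ S, ∫ ξ, w k ξ ∂μ) / 2 ≤
      ‖∑ k ∈ S, ∫ ξ, (w k ξ : ℂ) * Complex.exp (Complex.I * (θ k ξ : ℂ)) ∂μ‖ := by
  refine le_trans ?_ (sum_integral_mul_cos_le_norm S θ₀ hw hθ)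
  rw [Finset.sum_div]
  refine Finset.sum_le_sum fun k hk => ?_
  rw [← integral_div]
  refine integral_mono ((hw k hk).div_const 2) ?_ fun ξ => ?_
  · have hθk := hθ k hk
    refine (hw k hk).mul_bdd (c := 1) ?_ ?_
    · exact (by fun_prop : Continuous fun ξ => Real.cos (θ k ξ - θ₀)).aestronglyMeasurable
    · exact Filter.Eventually.of_forall fun y => Real.abs_cos_le_one _
  · by_cases h : w k ξ = 0
    · simp [h]
    · have h1 := hosc k hk ξ h
      have h2 := Real.one_sub_sq_div_two_le_cos (x := θ k ξ - θ₀)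
      have h3 : (θ k ξ - θ₀) ^ 2 ≤ 1 := (sq_le_one_iff_abs_le_one _).mpr h1
      simp only []
      nlinarith [hw0 k ξ]

/-! ### Bumps at lattice points and their modulation norm -/

/-- A smooth bump function on `ℝⁿ` supported in the cube `[-1/8, 1/8]ⁿ`. -/
noncomputable def cubeBump (n : ℕ) : ContDiffBump (0 : Fin n → ℝ) where
  rIn := 1 / 16
  rOut := 1 / 8
  rIn_pos := by norm_num
  rIn_lt_rOut := by norm_num

theorem abs_lt_of_cubeBump_ne_zero {n : ℕ} {ξ : Fin n → ℝ} (h : cubeBump n ξ ≠ 0) (j : Fin n) :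
    |ξ j| < 1 / 8 := by
  have h1 : ξ ∈ Function.support (cubeBump n) := h
  rw [ContDiffBump.support_eq, mem_ball_zero_iff] at h1
  exact (norm_le_pi_norm ξ j).trans_lt h1

/-- `cubeBump` as a complex valued Schwartz function. -/
noncomputable def freqBump (n : ℕ) : 𝓢(Fin n → ℝ, ℂ) :=
  HasCompactSupport.toSchwartzMap (f := fun ξ => ((cubeBump n ξ : ℝ) : ℂ))
    ((cubeBump n).hasCompactSupport.comp_left (g := Complex.ofReal) Complex.ofReal_zero)
    (Complex.ofRealCLM.contDiff.comp (cubeBump n).contDiff)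

theorem freqBump_apply {n : ℕ} (ξ : Fin n → ℝ) : freqBump n ξ = ((cubeBump n ξ : ℝ) : ℂ) := rfl

/-- An integer vector as a real vector. -/
def toRealVec {n : ℕ} (b : Fin n → ℤ) : Fin n → ℝ := fun j => (b j : ℝ)

/-- The sum of the translates of `cubeBump` by the lattice points in `T`. -/
noncomputable def latticeBump {n : ℕ} (T : Finset (Fin n → ℤ)) (ξ : Fin n → ℝ) : ℝ :=
  ∑ b ∈ T, cubeBump n (ξ - toRealVec b)

/-- The function on the cylinder whose Fourier transform consists of a bump at each point of
`S × T`. -/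
noncomputable def latticeWave {m n : ℕ} (S : Finset (Fin m → ℤ)) (T : Finset (Fin n → ℤ)) :
    Cyl m n → ℂ :=
  waveSum S fun _ => ∑ b ∈ T, SchwartzMap.compSubConstCLM ℂ (toRealVec b) (freqBump n)

theorem latticeBump_apply {n : ℕ} (T : Finset (Fin n → ℤ)) (ξ : Fin n → ℝ) :
    (∑ b ∈ T, SchwartzMap.compSubConstCLM ℂ (toRealVec b) (freqBump n)) ξ =
      ((latticeBump T ξ : ℝ) : ℂ) := by
  simp [latticeBump, SchwartzMap.compSubConstCLM_apply, freqBump_apply]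

theorem integrable_cubeBump_sub {n : ℕ} (b : Fin n → ℝ) :
    Integrable fun ξ => cubeBump n (ξ - b) :=
  (cubeBump n).integrable.comp_sub_right b

theorem integrable_latticeBump {n : ℕ} (T : Finset (Fin n → ℤ)) : Integrable (latticeBump T) :=
  integrable_finsetSum _ fun _ _ => integrable_cubeBump_sub _

theorem integral_latticeBump {n : ℕ} (T : Finset (Fin n → ℤ)) :
    ∫ ξ, latticeBump T ξ = T.card * ∫ ξ, cubeBump n ξ := by
  simp only [latticeBump]
  rw [integral_finsetSum _ fun b _ => integrable_cubeBump_sub _,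
    Finset.sum_congr rfl fun b _ =>
      integral_sub_right_eq_self (fun ξ => cubeBump n ξ) (toRealVec b)]
  simp

theorem latticeBump_nonneg {n : ℕ} (T : Finset (Fin n → ℤ)) (ξ : Fin n → ℝ) :
    0 ≤ latticeBump T ξ := Finset.sum_nonneg fun _ _ => (cubeBump n).nonneg

theorem exists_of_latticeBump_ne_zero {n : ℕ} {T : Finset (Fin n → ℤ)} {ξ : Fin n → ℝ}
    (h : latticeBump T ξ ≠ 0) : ∃ b ∈ T, ∀ j, |ξ j - b j| < 1 / 8 := by
  obtain ⟨b, hb, h⟩ := Finset.exists_ne_zero_of_sum_ne_zero h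
  exact ⟨b, hb, fun j => abs_lt_of_cubeBump_ne_zero h j⟩

theorem schrodinger_latticeWave {m n : ℕ} (S : Finset (Fin m → ℤ)) (T : Finset (Fin n → ℤ))
    (t : ℝ) (z : Cyl m n) :
    schrodinger t (latticeWave S T) z = ∑ k ∈ S, ∫ ξ, (latticeBump T ξ : ℂ) *
      Complex.exp (Complex.I * ((cylPhase k ξ z - t * freqSq k ξ : ℝ) : ℂ)) := by
  rw [schrodinger, latticeWave, cylMultiplier_waveSum]
  refine Finset.sum_congr rfl fun k _ => ?_
  congr 1; funext ξ
  rw [latticeBump_apply, mul_comm (Complex.exp _), mul_assoc, ← Complex.exp_add]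
  push_cast
  ring_nf

theorem continuous_cylPhase {m n : ℕ} (k : Fin m → ℤ) (z : Cyl m n) :
    Continuous fun ξ : Fin n → ℝ => cylPhase k ξ z := by
  unfold cylPhase; fun_prop

theorem continuous_freqSq {m n : ℕ} (k : Fin m → ℤ) :
    Continuous fun ξ : Fin n → ℝ => freqSq k ξ := by
  unfold freqSq; fun_prop

theorem le_norm_schrodinger_latticeWave {m n : ℕ} (S : Finset (Fin m → ℤ))
    (T : Finset (Fin n → ℤ)) (t θ₀ : ℝ) (z : Cyl m n)
    (h : ∀ k ∈ S, ∀ ξ, latticeBump T ξ ≠ 0 → |cylPhase k ξ z - t * freqSq k ξ - θ₀| ≤ 1) :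
    (S.card * (T.card * ∫ ξ, cubeBump n ξ)) / 2 ≤ ‖schrodinger t (latticeWave S T) z‖ := by
  rw [schrodinger_latticeWave]
  have := half_sum_integral_le_norm S (w := fun _ => latticeBump T)
    (θ := fun k ξ => cylPhase k ξ z - t * freqSq k ξ) θ₀
    (fun k _ => integrable_latticeBump T) (fun k _ => (continuous_cylPhase k z).sub
      (continuous_const.mul (continuous_freqSq k)))
    (fun _ ξ => latticeBump_nonneg T ξ) h
  simpa [integral_latticeBump] using this

theorem Int.eq_of_abs_sub_lt_one {a b : ℤ} (h : |(a : ℝ) - b| < 1) : a = b := by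
  have : |a - b| < 1 := by exact_mod_cast h
  rw [Int.abs_lt_one_iff] at this
  linarith

theorem IsUnitCubePartition.abs_coord_le {m n : ℕ} {σ : Cyl m n → ℝ} (hσ : IsUnitCubePartition σ)
    {z : Cyl m n} (hz : σ z ≠ 0) : (∀ i, |z.1 i| ≤ 3 / 4) ∧ ∀ j, |z.2 j| ≤ 3 / 4 := by
  obtain ⟨h1, h2⟩ := hσ.support (subset_tsupport σ hz)
  exact ⟨fun i => abs_le.mpr ⟨(h1 i).1, (h1 i).2.le⟩, fun j => abs_le.mpr ⟨(h2 j).1, (h2 j).2.le⟩⟩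

/-- Near a lattice point `(k, b)` only the member `σ_{(k, b)}` of the partition is nonzero. -/
theorem IsUnitCubePartition.eq_of_ne_zero {m n : ℕ} {σ : Cyl m n → ℝ}
    (hσ : IsUnitCubePartition σ) {K : (Fin m → ℤ) × (Fin n → ℤ)} {k : Fin m → ℤ}
    {b : Fin n → ℤ} {ξ : Fin n → ℝ} (hξ : ∀ j, |ξ j - b j| < 1 / 8)
    (h : latticeTranslate σ K (fun i => (k i : ℝ), ξ) ≠ 0) : K = (k, b) := by
  obtain ⟨h1, h2⟩ := hσ.abs_coord_le h
  refine Prod.ext (funext fun i => ?_) (funext fun j => ?_)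
  · exact (Int.eq_of_abs_sub_lt_one ((h1 i).trans_lt (by norm_num))).symm
  -- The support radius `3/4` of `σ_0` plus the bump radius `1/8` is still less than `1`, the
  -- spacing of the lattice.
  · refine Int.eq_of_abs_sub_lt_one ?_
    have h3 := h2 j
    have h4 := hξ j
    simp only [abs_le, abs_lt] at h3 h4 ⊢
    constructor <;> linarith [h3.1, h3.2, h4.1, h4.2]

theorem IsUnitCubePartition.eq_one {m n : ℕ} {σ : Cyl m n → ℝ}
    (hσ : IsUnitCubePartition σ) {k : Fin m → ℤ}
    {b : Fin n → ℤ} {ξ : Fin n → ℝ} (hξ : ∀ j, |ξ j - b j| < 1 / 8) :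
    latticeTranslate σ (k, b) (fun i => (k i : ℝ), ξ) = 1 := by
  have h := hσ.sum_eq_one (fun i => (k i : ℝ), ξ)
  refine (hasSum_single (k, b) fun K hK => ?_).unique h
  by_contra h0
  exact hK (hσ.eq_of_ne_zero hξ h0)

theorem IsUnitCubePartition.mul_cubeBump {m n : ℕ} {σ : Cyl m n → ℝ}
    (hσ : IsUnitCubePartition σ) (K : (Fin m → ℤ) × (Fin n → ℤ)) (k : Fin m → ℤ)
    (b : Fin n → ℤ) (ξ : Fin n → ℝ) :
    latticeTranslate σ K (fun i => (k i : ℝ), ξ) * cubeBump n (ξ - toRealVec b) =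
      if K = (k, b) then cubeBump n (ξ - toRealVec b) else 0 := by
  by_cases h : cubeBump n (ξ - toRealVec b) = 0
  · simp [h]
  have hξ : ∀ j, |ξ j - b j| < 1 / 8 := fun j => abs_lt_of_cubeBump_ne_zero h j
  split_ifs with hK
  · rw [hK, hσ.eq_one hξ, one_mul]
  · rw [mul_eq_zero]
    left
    by_contra h0
    exact hK (hσ.eq_of_ne_zero hξ h0)

theorem IsUnitCubePartition.mul_latticeBump {m n : ℕ} {σ : Cyl m n → ℝ}
    (hσ : IsUnitCubePartition σ) (K : (Fin m → ℤ) × (Fin n → ℤ)) (k : Fin m → ℤ)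
    (T : Finset (Fin n → ℤ)) (ξ : Fin n → ℝ) :
    latticeTranslate σ K (fun i => (k i : ℝ), ξ) * latticeBump T ξ =
      if K.1 = k then (if K.2 ∈ T then cubeBump n (ξ - toRealVec K.2) else 0) else 0 := by
  rw [latticeBump, Finset.mul_sum]
  simp only [hσ.mul_cubeBump, Prod.ext_iff]
  by_cases h : K.1 = k
  · simp [h]
  · simp [h]

/-- On the support of the bumps `σ_K` is either `0` or `1`, and it keeps exactly the bump at `K`.
Translating that bump to the origin in frequency turns the result into a modulation of one fixed
profile, so its `L^p` norm does not depend on `K`. -/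
theorem boxOp_latticeWave {m n : ℕ} {σ : Cyl m n → ℝ} (hσ : IsUnitCubePartition σ)
    (K : (Fin m → ℤ) × (Fin n → ℤ)) (S : Finset (Fin m → ℤ)) (T : Finset (Fin n → ℤ))
    (z : Cyl m n) :
    boxOp σ K (latticeWave S T) z =
      if K ∈ S ×ˢ T then Complex.exp (Complex.I * (cylPhase K.1 (toRealVec K.2) z : ℂ)) *
        invFourier (freqBump n) z.2 else 0 := by
  rw [boxOp, latticeWave, cylMultiplier_waveSum]
  simp only [latticeBump_apply, ← Complex.ofReal_mul, hσ.mul_latticeBump, Finset.mem_product]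
  by_cases hT : K.2 ∈ T
  · have hshift : ∫ ξ, ((cubeBump n (ξ - toRealVec K.2) : ℝ) : ℂ) *
        Complex.exp (Complex.I * (cylPhase K.1 ξ z : ℂ)) =
        Complex.exp (Complex.I * (cylPhase K.1 (toRealVec K.2) z : ℂ)) *
        invFourier (freqBump n) z.2 := by
      rw [invFourier_apply, ← integral_const_mul,
        ← integral_add_right_eq_self _ (toRealVec K.2)]
      congr 1; funext ξ
      rw [add_sub_cancel_right, freqBump_apply, mul_left_comm, ← Complex.exp_add]
      congr 2
      simp only [cylPhase, Pi.add_apply, add_mul, Finset.sum_add_distrib]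
      push_cast
      ring
    by_cases hS : K.1 ∈ S
    · rw [Finset.sum_eq_single K.1]
      · simp [hS, hT, hshift]
      · intro k _ hk
        simp [hk.symm]
      · exact fun h => absurd hS h
    · simp only [hS, false_and, if_false]
      refine Finset.sum_eq_zero fun k hk => ?_
      have : K.1 ≠ k := fun h => hS (h ▸ hk)
      simp [this]
  · simp [hT]

theorem eLpNorm_snd_ne_top (m : ℕ) {n : ℕ} (h : 𝓢(Fin n → ℝ, ℂ)) (p : ℝ≥0∞) :
    eLpNorm (fun z : Cyl m n => h z.2) p (cylMeasure m n) ≠ ∞ := by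
  have : IsFiniteMeasure ((volume : Measure (Fin m → ℝ)).restrict
      (Set.Icc 0 (fun _ => 2 * Real.pi))) := ⟨by
    rw [Measure.restrict_apply_univ]; exact isCompact_Icc.measure_lt_top⟩
  exact ((h.memLp p volume).comp_snd
    ((volume : Measure (Fin m → ℝ)).restrict (Set.Icc 0 (fun _ => 2 * Real.pi)))).eLpNorm_ne_top

/-- The common `L^p` norm of the frequency-localized pieces of `latticeWave`. -/
noncomputable def bumpNorm (m n : ℕ) (p : ℝ≥0∞) : ℝ≥0∞ :=
  eLpNorm (fun z : Cyl m n => invFourier (freqBump n) z.2) p (cylMeasure m n)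

theorem bumpNorm_ne_top (m n : ℕ) (p : ℝ≥0∞) : bumpNorm m n p ≠ ∞ :=
  eLpNorm_snd_ne_top m (invFourier (freqBump n)) p

theorem modulationNorm_latticeWave_le {m n : ℕ} {σ : Cyl m n → ℝ} (hσ : IsUnitCubePartition σ)
    (S : Finset (Fin m → ℤ)) (T : Finset (Fin n → ℤ)) (α : ℝ) (p q : ℝ≥0∞) {B : ℝ}
    (hB : ∀ K ∈ S ×ˢ T, japanese K ^ α ≤ B) :
    modulationNorm σ α p q (latticeWave S T) ≤
      ENNReal.ofReal B * bumpNorm m n p * ((S.card * T.card : ℕ) : ℝ≥0∞) ^ (q⁻¹).toReal := by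
  have hbox : ∀ K, eLpNorm (boxOp σ K (latticeWave S T)) p (cylMeasure m n) ≤
      if K ∈ S ×ˢ T then bumpNorm m n p else 0 := by
    intro K
    split_ifs with hK
    · refine eLpNorm_mono fun z => ?_
      rw [boxOp_latticeWave hσ, if_pos hK, norm_mul, mul_comm Complex.I,
        Complex.norm_exp_ofReal_mul_I, one_mul]
    · have : boxOp σ K (latticeWave S T) = 0 := by
        funext z
        rw [boxOp_latticeWave hσ, if_neg hK]; rfl
      simp [this]
  have hcount : Measure.count ((S ×ˢ T : Finset ((Fin m → ℤ) × (Fin n → ℤ))) : Set ((Fin m → ℤ) × (Fin n → ℤ))) =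
      ((S.card * T.card : ℕ) : ℝ≥0∞) := by
    rw [Measure.count_apply_finset, Finset.card_product]
  have := eLpNorm_indicator_const_le (μ := Measure.count)
    (s := ((S ×ˢ T : Finset ((Fin m → ℤ) × (Fin n → ℤ))) : Set ((Fin m → ℤ) × (Fin n → ℤ))))
    (ENNReal.ofReal B * bumpNorm m n p) q
  rw [hcount, enorm_eq_self, one_div, ← ENNReal.toReal_inv] at this
  refine le_trans (eLpNorm_mono_enorm fun K => ?_) this
  simp only [enorm_eq_self]
  by_cases hK : K ∈ S ×ˢ T
  · rw [Set.indicator_of_mem (by exact_mod_cast hK)]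
    have h1 := hbox K
    rw [if_pos hK] at h1
    exact mul_le_mul' (ENNReal.ofReal_le_ofReal (hB K hK)) h1
  · have h1 := hbox K
    rw [if_neg hK] at h1
    rw [Set.indicator_of_notMem (by exact_mod_cast hK)]
    rw [nonpos_iff_eq_zero.mp h1, mul_zero]

/-! ### Necessary conditions on modulation spaces -/

theorem le_spaceTimeNorm {m n : ℕ} {p : ℝ≥0∞} (hp : 1 ≤ p) {f : Cyl m n → ℂ} {ρ τ c : ℝ}
    (hρ0 : 0 < ρ) (hρ : ρ ≤ 1) (hτ0 : 0 < τ) (hτ : τ ≤ 1)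
    (h : ∀ z : Cyl m n, z ∈ Set.Icc (0 : Fin m → ℝ) (fun _ => ρ) ×ˢ
      Set.Icc (0 : Fin n → ℝ) (fun _ => ρ) → ∀ t ∈ Set.Icc 0 τ, c ≤ ‖schrodinger t f z‖) :
    ENNReal.ofReal c * ENNReal.ofReal (ρ ^ (m + n) * τ) ^ (p⁻¹).toReal ≤ spaceTimeNorm p f := by
  have hμ : ((cylMeasure m n).prod timeMeasure)
      ((Set.Icc (0 : Fin m → ℝ) (fun _ => ρ) ×ˢ Set.Icc (0 : Fin n → ℝ) (fun _ => ρ)) ×ˢ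
        Set.Icc 0 τ) = ENNReal.ofReal (ρ ^ (m + n) * τ) := by
    have : SFinite timeMeasure := by unfold timeMeasure; infer_instance
    rw [Measure.prod_prod, cylMeasure_cube m n hρ0.le (by linarith [Real.pi_gt_three]),
      timeMeasure_Icc le_rfl hτ, sub_zero, ENNReal.ofReal_mul (by positivity)]
  rw [← hμ]
  refine mul_measure_rpow_le_eLpNorm
    ((measurableSet_Icc.prod measurableSet_Icc).prod measurableSet_Icc) ?_ hp ?_
  · rw [hμ]
    exact (ENNReal.ofReal_pos.mpr (by positivity)).ne'
  · rintro ⟨z, t⟩ ⟨hz, ht⟩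
    rw [← ofReal_norm]
    exact ENNReal.ofReal_le_ofReal (h z hz t ht)

theorem abs_cylPhase_le {m n : ℕ} {k : Fin m → ℤ} {ξ : Fin n → ℝ} {z : Cyl m n} {R ρ : ℝ}
    (hk : ∀ i, |(k i : ℝ)| ≤ R) (hξ : ∀ j, |ξ j| ≤ R) (hx : ∀ i, |z.1 i| ≤ ρ)
    (hy : ∀ j, |z.2 j| ≤ ρ) : |cylPhase k ξ z| ≤ (m + n) * (R * ρ) := by
  refine (abs_add_le _ _).trans ?_
  have h1 : |∑ i, (k i : ℝ) * z.1 i| ≤ ∑ _i : Fin m, R * ρ :=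
    (Finset.abs_sum_le_sum_abs _ _).trans (Finset.sum_le_sum fun i _ => by
      rw [abs_mul]
      exact mul_le_mul (hk i) (hx i) (abs_nonneg _) ((abs_nonneg _).trans (hk i)))
  have h2 : |∑ j, ξ j * z.2 j| ≤ ∑ _j : Fin n, R * ρ :=
    (Finset.abs_sum_le_sum_abs _ _).trans (Finset.sum_le_sum fun i _ => by
      rw [abs_mul]
      exact mul_le_mul (hξ i) (hy i) (abs_nonneg _) ((abs_nonneg _).trans (hξ i)))
  simp only [Finset.sum_const, Finset.card_univ, Fintype.card_fin, nsmul_eq_mul] at h1 h2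
  linarith

theorem freqSq_nonneg {m n : ℕ} (k : Fin m → ℤ) (ξ : Fin n → ℝ) : 0 ≤ freqSq k ξ := by
  unfold freqSq; positivity

theorem freqSq_le {m n : ℕ} {k : Fin m → ℤ} {ξ : Fin n → ℝ} {R : ℝ}
    (hk : ∀ i, |(k i : ℝ)| ≤ R) (hξ : ∀ j, |ξ j| ≤ R) : freqSq k ξ ≤ (m + n) * R ^ 2 := by
  have h1 : ∑ i, (k i : ℝ) ^ 2 ≤ ∑ _i : Fin m, R ^ 2 :=
    Finset.sum_le_sum fun i _ => sq_le_sq' (abs_le.mp (hk i)).1 (abs_le.mp (hk i)).2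
  have h2 : ∑ j, ξ j ^ 2 ≤ ∑ _j : Fin n, R ^ 2 :=
    Finset.sum_le_sum fun i _ => sq_le_sq' (abs_le.mp (hξ i)).1 (abs_le.mp (hξ i)).2
  simp only [Finset.sum_const, Finset.card_univ, Fintype.card_fin, nsmul_eq_mul] at h1 h2
  unfold freqSq
  linarith

theorem abs_le_of_mem_cube {d : ℕ} {x : Fin d → ℝ} {ρ : ℝ}
    (hx : x ∈ Set.Icc (0 : Fin d → ℝ) (fun _ => ρ)) (i : Fin d) : |x i| ≤ ρ := by
  rw [abs_of_nonneg (hx.1 i)]; exact hx.2 i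

theorem integral_cubeBump_pos (n : ℕ) : 0 < ∫ ξ, cubeBump n ξ := (cubeBump n).integral_pos

theorem isCylSchwartz_latticeWave {m n : ℕ} (S : Finset (Fin m → ℤ)) (T : Finset (Fin n → ℤ)) :
    IsCylSchwartz (latticeWave S T : Cyl m n → ℂ) := isCylSchwartz_waveSum _ _

/-- A single bump travelling to infinity in the torus frequency. The frequency `k` contributes only
a phase common to the whole bump, so the lower bound is uniform in `L` while the weight is `⟨K⟩^α`;
the comparison is of exponent `0` with exponent `α`. -/
theorem modulation_exponent_nonneg {m n : ℕ} (hm : 1 ≤ m) (hn : 1 ≤ n) {σ : Cyl m n → ℝ}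
    (hσ : IsUnitCubePartition σ) {p q : ℝ≥0∞} {α : ℝ} (hp : 1 ≤ p) {C : ℝ≥0}
    (hC : ∀ f : Cyl m n → ℂ, IsCylSchwartz f →
        spaceTimeNorm p f ≤ C * modulationNorm σ α p q f) : 0 ≤ α := by
  set K : ℕ → (Fin m → ℤ) × (Fin n → ℤ) := fun L => (fun _ => (L : ℤ), 0) with hK
  have hnR : (1 : ℝ) ≤ n := by exact_mod_cast hn
  have hJ : ∀ L : ℕ, (L : ℝ) ≤ japanese (K L) := by
    intro L
    refine Real.le_sqrt_of_sq_le ?_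
    have : (1 : ℝ) * (L : ℝ) ^ 2 ≤ m * (L : ℝ) ^ 2 := by gcongr; exact_mod_cast hm
    simp [freqSq, hK]
    linarith
  have hu : Filter.Tendsto (fun L => japanese (K L)) Filter.atTop Filter.atTop :=
    Filter.tendsto_atTop_mono hJ tendsto_natCast_atTop_atTop
  set I := ∫ ξ, cubeBump n ξ
  have hI : 0 < I := integral_cubeBump_pos n
  set ρ : ℝ := 1 / n
  have hρ0 : 0 < ρ := by positivity
  have hρ : ρ ≤ 1 := by rw [div_le_one (by positivity)]; exact hnR
  have hnρ : n * ρ = 1 := by simp only [ρ]; field_simp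
  refine le_of_eventually_mul_rpow_le hu (c := I / 2 * (ρ ^ (m + n) * ρ) ^ (p⁻¹).toReal)
    (C := C * (bumpNorm m n p).toReal) (by positivity) (Filter.Eventually.of_forall fun L => ?_)
  have hlow := le_spaceTimeNorm (m := m) (n := n) (f := latticeWave {(K L).1} {(K L).2}) hp
    (c := I / 2) hρ0 hρ hρ0 hρ (by
      intro z hz t ht
      -- The reference phase removes everything that involves `k`. What remains is `ξ·y - t|ξ|²`
      -- with `|ξ_j| ≤ 1/8`, bounded by `1/8 + 1/64` because `nρ = 1`.
      have := le_norm_schrodinger_latticeWave {(K L).1} {(K L).2} t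
        (∑ i, ((K L).1 i : ℝ) * z.1 i - t * ∑ i, ((K L).1 i : ℝ) ^ 2) z (by
          intro k hk ξ hξ
          rw [Finset.mem_singleton] at hk
          obtain ⟨b, hb, hξb⟩ := exists_of_latticeBump_ne_zero hξ
          rw [Finset.mem_singleton] at hb
          have hξ1 : ∀ j, |ξ j| ≤ 1 / 8 := fun j => by
            have := hξb j
            simp only [hb, hK] at this
            simpa using this.le
          -- The phase estimates are applied with an empty torus factor, which isolates the
          -- Euclidean part.
          have h1 := abs_cylPhase_le (k := (0 : Fin 0 → ℤ)) (z := (0, z.2)) (fun i => i.elim0) hξ1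
            (fun i => i.elim0) (abs_le_of_mem_cube hz.2)
          have h2 := freqSq_le (k := (0 : Fin 0 → ℤ)) (fun i => i.elim0) hξ1
          have h3 := freqSq_nonneg (0 : Fin 0 → ℤ) ξ
          simp only [cylPhase, freqSq, Finset.univ_eq_empty, Finset.sum_empty, zero_add,
            Nat.cast_zero] at h1 h2 h3
          have h4 : cylPhase k ξ z - t * freqSq k ξ -
              (∑ i, ((K L).1 i : ℝ) * z.1 i - t * ∑ i, ((K L).1 i : ℝ) ^ 2) =
              ∑ j, ξ j * z.2 j - t * ∑ j, ξ j ^ 2 := by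
            simp only [cylPhase, freqSq, hk]; ring
          rw [h4]
          have h5 : t * ∑ j, ξ j ^ 2 ≤ ρ * (n * (1 / 8) ^ 2) :=
            mul_le_mul ht.2 h2 h3 hρ0.le
          have h6 : 0 ≤ t * ∑ j, ξ j ^ 2 := mul_nonneg ht.1 h3
          rw [abs_le] at h1 ⊢
          constructor <;> nlinarith [h1.1, h1.2])
      simpa using this)
  have hup := modulationNorm_latticeWave_le hσ {(K L).1} {(K L).2} α p q
    (B := japanese (K L) ^ α) (by
      intro K' hK'
      rw [Finset.singleton_product_singleton, Finset.mem_singleton] at hK'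
      rw [hK'])
  simp only [Finset.card_singleton, mul_one, Nat.cast_one, ENNReal.one_rpow] at hup
  have hfin := (hlow.trans (hC _ (isCylSchwartz_latticeWave _ _))).trans
    (mul_le_mul_right hup _)
  have hJ0 : 0 ≤ japanese (K L) ^ α := Real.rpow_nonneg (Real.sqrt_nonneg _) _
  have := ENNReal.toReal_mono (by
    exact ENNReal.mul_ne_top ENNReal.coe_ne_top
      (ENNReal.mul_ne_top ENNReal.ofReal_ne_top (bumpNorm_ne_top m n p))) hfin
  rw [ENNReal.toReal_mul, ENNReal.toReal_mul, ENNReal.toReal_mul, ← ENNReal.toReal_rpow,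
    ENNReal.toReal_ofReal (by positivity), ENNReal.toReal_ofReal (by positivity),
    ENNReal.toReal_ofReal hJ0, ENNReal.coe_toReal] at this
  rw [Real.rpow_zero, mul_one]
  linarith

/-- The lattice cube `{0, …, N - 1}^d`. -/
noncomputable def latticeCube (d N : ℕ) : Finset (Fin d → ℤ) := Fintype.piFinset fun _ => Finset.Ico 0 (N : ℤ)

theorem card_latticeCube (d N : ℕ) : (latticeCube d N).card = N ^ d := by
  simp [latticeCube, Fintype.card_piFinset]

theorem abs_le_of_mem_latticeCube {d N : ℕ} {k : Fin d → ℤ} (hk : k ∈ latticeCube d N)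
    (i : Fin d) : |(k i : ℝ)| ≤ N - 1 := by
  have := Finset.mem_Ico.mp (Fintype.mem_piFinset.mp hk i)
  rw [abs_of_nonneg (by exact_mod_cast this.1)]
  have h2 : k i + 1 ≤ (N : ℤ) := this.2
  have h3 : (k i : ℝ) + 1 ≤ N := by exact_mod_cast h2
  linarith

/-- All `N^(m+n)` bumps of the lattice cube add up coherently near the origin. Nonnegativity of `α`
lets `⟨K⟩^α` be bounded by its value at the largest frequencies. -/
theorem modulation_exponent_ge {m n : ℕ} (hm : 1 ≤ m) {σ : Cyl m n → ℝ}
    (hσ : IsUnitCubePartition σ) {p q : ℝ≥0∞} {α : ℝ} (hp : 1 ≤ p) (hα : 0 ≤ α) {C : ℝ≥0}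
    (hC : ∀ f : Cyl m n → ℂ, IsCylSchwartz f →
        spaceTimeNorm p f ≤ C * modulationNorm σ α p q f) :
    ((m : ℝ) + n) * (1 - (p⁻¹).toReal - (q⁻¹).toReal) - 2 * (p⁻¹).toReal ≤ α := by
  set D : ℝ := (m : ℝ) + n with hD
  have hD1 : 1 ≤ D := by
    have : (1 : ℝ) ≤ m := by exact_mod_cast hm
    have : (0 : ℝ) ≤ n := by positivity
    linarith
  set I := ∫ ξ, cubeBump n ξ
  have hI : 0 < I := integral_cubeBump_pos n
  set ip := (p⁻¹).toReal
  set iq := (q⁻¹).toReal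
  -- Left: amplitude `N^D` times the measure `N^(-(D+2))` to the power `1/p`. Right: the weight
  -- `N^α` times the number `N^D` of boxes to the power `1/q`.
  suffices D - (D + 2) * ip ≤ α + D * iq by linarith
  refine le_of_eventually_mul_rpow_le tendsto_natCast_atTop_atTop
    (c := I / 2 * (1 / (2 * D) ^ (m + n + 1)) ^ ip)
    (C := C * (bumpNorm m n p).toReal * Real.sqrt (1 + D) ^ α) (by positivity) ?_
  filter_upwards [Filter.eventually_ge_atTop 1] with N hN
  have hN1 : (1 : ℝ) ≤ N := by exact_mod_cast hN
  have hN0 : (0 : ℝ) < N := by linarith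
  set x : ℝ := (N : ℝ)
  -- With these sizes the spatial phase and the temporal phase are each at most `1/2`, for a total
  -- of at most `1`.
  set ρ : ℝ := 1 / (2 * D * x) with hρdef
  set τ : ℝ := 1 / (2 * D * x ^ 2) with hτdef
  have hDx : 1 ≤ 2 * D * x := by nlinarith
  have hDx2 : 1 ≤ 2 * D * x ^ 2 := by nlinarith
  have hlow := le_spaceTimeNorm (m := m) (n := n) (f := latticeWave (latticeCube m N)
    (latticeCube n N)) hp (ρ := ρ) (τ := τ) (c := x ^ m * (x ^ n * I) / 2) (by positivity)
    (by rw [hρdef, div_le_one (by positivity)]; exact hDx) (by positivity)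
    (by rw [hτdef, div_le_one (by positivity)]; exact hDx2) (by
      intro z hz t ht
      have := le_norm_schrodinger_latticeWave (latticeCube m N) (latticeCube n N) t 0 z (by
          intro k hk ξ hξ
          obtain ⟨b, hb, hξb⟩ := exists_of_latticeBump_ne_zero hξ
          have hk1 : ∀ i, |(k i : ℝ)| ≤ x := fun i =>
            (abs_le_of_mem_latticeCube hk i).trans (by linarith)
          -- The lattice cube stops at `N - 1`, which leaves room for the bump radius `1/8`.
          have hξ1 : ∀ j, |ξ j| ≤ x := fun j => by
            have h1 := hξb j
            have h2 := abs_le_of_mem_latticeCube hb j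
            have h3 := abs_sub_abs_le_abs_sub (ξ j) (b j)
            linarith
          have h1 := abs_cylPhase_le hk1 hξ1 (abs_le_of_mem_cube hz.1) (abs_le_of_mem_cube hz.2)
          have h2 := freqSq_le hk1 hξ1
          have h3 := freqSq_nonneg k ξ
          have h4 : D * (x * ρ) = 1 / 2 := by rw [hρdef]; field_simp
          have h5 : τ * (D * x ^ 2) = 1 / 2 := by rw [hτdef]; field_simp
          have h6 : t * freqSq k ξ ≤ τ * (D * x ^ 2) := mul_le_mul ht.2 h2 h3 (by positivity)
          have h7 : 0 ≤ t * freqSq k ξ := mul_nonneg ht.1 h3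
          rw [h4] at h1
          rw [abs_le] at h1 ⊢
          constructor <;> linarith [h1.1, h1.2])
      simpa [card_latticeCube] using this)
  have hup := modulationNorm_latticeWave_le hσ (latticeCube m N) (latticeCube n N) α p q
    (B := (Real.sqrt (1 + D) * x) ^ α) (by
      intro K hK
      rw [Finset.mem_product] at hK
      refine Real.rpow_le_rpow (Real.sqrt_nonneg _) ?_ hα
      refine Real.sqrt_le_iff.mpr ⟨by positivity, ?_⟩
      rw [mul_pow, Real.sq_sqrt (by positivity)]
      have := freqSq_le (ξ := fun j => (K.2 j : ℝ)) (R := x)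
        (fun i => (abs_le_of_mem_latticeCube hK.1 i).trans (by linarith))
        (fun i => (abs_le_of_mem_latticeCube hK.2 i).trans (by linarith))
      nlinarith)
  have hfin := (hlow.trans (hC _ (isCylSchwartz_latticeWave _ _))).trans
    (mul_le_mul_right hup _)
  have hiq : 0 ≤ iq := ENNReal.toReal_nonneg
  have := ENNReal.toReal_mono (by
    refine ENNReal.mul_ne_top ENNReal.coe_ne_top (ENNReal.mul_ne_top
      (ENNReal.mul_ne_top ENNReal.ofReal_ne_top (bumpNorm_ne_top m n p)) ?_)
    exact ENNReal.rpow_ne_top_of_nonneg hiq (ENNReal.natCast_ne_top _)) hfin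
  rw [ENNReal.toReal_mul, ENNReal.toReal_mul, ENNReal.toReal_mul, ENNReal.toReal_mul,
    ← ENNReal.toReal_rpow, ← ENNReal.toReal_rpow,
    ENNReal.toReal_ofReal (by positivity), ENNReal.toReal_ofReal (by positivity),
    ENNReal.toReal_ofReal (by positivity), ENNReal.coe_toReal, ENNReal.toReal_natCast,
    card_latticeCube, card_latticeCube] at this
  have hxD : x ^ m * x ^ n = x ^ D := by
    rw [hD, Real.rpow_add hN0, Real.rpow_natCast, Real.rpow_natCast]
  have hvol : ρ ^ (m + n) * τ = 1 / (2 * D) ^ (m + n + 1) * x ^ (-(D + 2)) := by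
    have h2 : x ^ (D + 2) = x ^ (m + n) * x ^ 2 := by
      rw [Real.rpow_add hN0, ← hxD, pow_add]; norm_cast
    rw [Real.rpow_neg hN0.le, h2, hρdef, hτdef, div_pow, mul_pow]
    field_simp
    ring
  have hL : x ^ m * (x ^ n * I) / 2 * (ρ ^ (m + n) * τ) ^ ip =
      I / 2 * (1 / (2 * D) ^ (m + n + 1)) ^ ip * x ^ (D - (D + 2) * ip) := by
    rw [hvol, Real.mul_rpow (by positivity) (by positivity), ← Real.rpow_mul hN0.le,
      sub_eq_add_neg, Real.rpow_add hN0, ← hxD, neg_mul]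
    ring
  have hR : ((N ^ m * N ^ n : ℕ) : ℝ) ^ iq = x ^ (D * iq) := by
    push_cast
    rw [hxD, Real.rpow_mul hN0.le]
  rw [hL, hR, Real.mul_rpow (by positivity) (by positivity)] at this
  rw [Real.rpow_add hN0]
  linarith

/-! ### Weyl's bound for quadratic exponential sums -/

/-- The bookkeeping of Weyl differencing: the square of a sum is sorted by the difference of the two
indices, and the pairs with differences `±(h + 1)` are kept together. -/
theorem sum_range_sum_range_eq_diagonals {A : Type*} [AddCommGroup A] (F : ℕ → ℕ → A) (q : ℕ) :
    ∑ k ∈ Finset.range q, ∑ l ∈ Finset.range q, F k l =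
      ∑ k ∈ Finset.range q, F k k + ∑ h ∈ Finset.range q, ∑ l ∈ Finset.range (q - (h + 1)),
        (F (l + (h + 1)) l + F l (l + (h + 1))) := by
  induction q with
  | zero => simp
  | succ q ih =>
    have h1 : ∑ h ∈ Finset.range (q + 1), ∑ l ∈ Finset.range (q + 1 - (h + 1)),
        (F (l + (h + 1)) l + F l (l + (h + 1))) =
        ∑ h ∈ Finset.range q, ∑ l ∈ Finset.range (q - (h + 1)),
        (F (l + (h + 1)) l + F l (l + (h + 1))) +
        ∑ l ∈ Finset.range q, (F q l + F l q) := by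
      rw [Finset.sum_range_succ, Nat.sub_self, Finset.range_zero, Finset.sum_empty, add_zero,
        ← Finset.sum_range_reflect (fun l => F q l + F l q), ← Finset.sum_add_distrib]
      refine Finset.sum_congr rfl fun h hh => ?_
      have hq : h < q := Finset.mem_range.mp hh
      have e1 : q + 1 - (h + 1) = q - (h + 1) + 1 := by omega
      have e2 : q - (h + 1) + (h + 1) = q := by omega
      have e3 : q - 1 - h = q - (h + 1) := by omega
      rw [e1, Finset.sum_range_succ, e2, e3]
    rw [h1, Finset.sum_range_succ (fun k => F k k), Finset.sum_range_succ]
    simp only [Finset.sum_range_succ, Finset.sum_add_distrib] at ih ⊢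
    rw [ih]
    abel

theorem norm_geom_sum_le {w : ℂ} (hw : ‖w‖ = 1) (hw1 : w ≠ 1) (M : ℕ) :
    ‖∑ l ∈ Finset.range M, w ^ l‖ ≤ 2 / ‖w - 1‖ := by
  rw [geom_sum_eq hw1, norm_div]
  gcongr
  refine (norm_sub_le _ _).trans ?_
  rw [norm_pow, hw]; norm_num

/-- For `0 < r < q` the distance of `e^{2πir/q}` to `1` is at least `4 min (r, q - r) / q`. -/
theorem inv_norm_exp_sub_one_le {q r : ℕ} (hr : 0 < r) (hrq : r < q) :
    1 / ‖Complex.exp (Complex.I * ((2 * Real.pi * r / q : ℝ) : ℂ)) - 1‖ ≤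
      q / 4 * (1 / r + 1 / ((q - r : ℕ) : ℝ)) := by
  have hq : (0 : ℝ) < q := by exact_mod_cast hr.trans hrq
  have hr' : (0 : ℝ) < r := by exact_mod_cast hr
  have hrq' : (r : ℝ) < q := by exact_mod_cast hrq
  have hsub : ((q - r : ℕ) : ℝ) = q - r := by rw [Nat.cast_sub hrq.le]
  have hs : (0 : ℝ) < q - r := by linarith
  have hpi := Real.pi_pos
  rw [Complex.norm_exp_I_mul_ofReal_sub_one, hsub]
  -- Jordan's inequality `sin θ ≥ 2θ/π` on `[0, π/2]`. The case `r > q/2` is reduced to it by the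
  -- reflection `r ↦ q - r`, and the maximum of the two bounds is replaced by their sum.
  have hkey : ∀ s : ℝ, 0 < s → s ≤ q / 2 → 2 * s / q ≤ Real.sin (Real.pi * s / q) := by
    intro s hs0 hs1
    have h1 : Real.pi * s / q ≤ Real.pi / 2 := by
      rw [div_le_iff₀ hq]; nlinarith
    have := Real.mul_le_sin (by positivity : 0 ≤ Real.pi * s / q) h1
    calc 2 * s / q = 2 / Real.pi * (Real.pi * s / q) := by field_simp
      _ ≤ _ := this
  have hang : 2 * Real.pi * r / q / 2 = Real.pi * r / q := by ring
  rw [hang, norm_mul, Real.norm_eq_abs, Real.norm_eq_abs, abs_two]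
  rcases le_total (r : ℝ) (q / 2) with h | h
  · have h1 := hkey r hr' h
    have h2 : 0 < 2 * (r : ℝ) / q := by positivity
    rw [abs_of_pos (h2.trans_le h1)]
    calc 1 / (2 * Real.sin (Real.pi * r / q)) ≤ 1 / (2 * (2 * r / q)) := by gcongr
      _ = q / 4 * (1 / r) := by field_simp; ring
      _ ≤ _ := by
        refine mul_le_mul_of_nonneg_left ?_ (by positivity)
        linarith [div_pos one_pos hs]
  · have h1 := hkey (q - r) hs (by linarith)
    have h2 : 0 < 2 * (q - r : ℝ) / q := by positivity
    have h3 : Real.sin (Real.pi * r / q) = Real.sin (Real.pi * (q - r) / q) := by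
      rw [← Real.sin_pi_sub]; congr 1; field_simp
    rw [h3, abs_of_pos (h2.trans_le h1)]
    calc 1 / (2 * Real.sin (Real.pi * (q - r) / q)) ≤ 1 / (2 * (2 * (q - r) / q)) := by gcongr
      _ = q / 4 * (1 / (q - r)) := by field_simp; ring
      _ ≤ _ := by gcongr; simp

theorem sum_inv_range_le_one_add_log (q : ℕ) :
    ∑ r ∈ Finset.range (q - 1), (1 : ℝ) / ((r + 1 : ℕ) : ℝ) ≤ 1 + Real.log q := by
  have h := harmonic_le_one_add_log (q - 1)
  have h2 : ((harmonic (q - 1) : ℚ) : ℝ) = ∑ r ∈ Finset.range (q - 1), (1 : ℝ) / ((r + 1 : ℕ) : ℝ) := by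
    simp [harmonic]
  rw [h2] at h
  have h3 : Real.log ((q - 1 : ℕ) : ℝ) ≤ Real.log q := by
    rcases Nat.eq_zero_or_pos (q - 1) with h0 | h0
    · rw [h0, Nat.cast_zero, Real.log_zero]
      exact Real.log_natCast_nonneg q
    · exact Real.log_le_log (by exact_mod_cast h0) (by exact_mod_cast Nat.sub_le q 1)
  linarith

/-- Multiplication by `a` permutes the nonzero residues modulo `q`, so the terms are the values at
`r = 1, …, q - 1` in another order. Each is at most `q/4 · (1/r + 1/(q-r))`, and the two harmonic
sums give the logarithm. -/
theorem sum_inv_norm_exp_sub_one_le {a q : ℕ} (hq : 1 ≤ q) (haq : Nat.Coprime a q) :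
    ∑ h ∈ Finset.range (q - 1),
      1 / ‖Complex.exp (Complex.I * ((2 * Real.pi * (a * (h + 1) : ℕ) / q : ℝ) : ℂ)) - 1‖ ≤
      q / 2 * (1 + Real.log q) := by
  set g : ℕ → ℝ := fun r => 1 / ‖Complex.exp (Complex.I * ((2 * Real.pi * r / q : ℝ) : ℂ)) - 1‖
  have hqR : (q : ℝ) ≠ 0 := by positivity
  have hmod : ∀ r, g r = g (r % q) := by
    intro r
    simp only [g]
    have : (r : ℝ) = (r % q : ℕ) + q * (r / q : ℕ) := by exact_mod_cast (Nat.mod_add_div r q).symm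
    have h2 : Complex.I * ((2 * Real.pi * r / q : ℝ) : ℂ) =
        Complex.I * ((2 * Real.pi * (r % q : ℕ) / q : ℝ) : ℂ) +
          ((r / q : ℕ) : ℂ) * (2 * Real.pi * Complex.I) := by
      have h3 : 2 * Real.pi * r / q = 2 * Real.pi * (r % q : ℕ) / q + 2 * Real.pi * (r / q : ℕ) := by
        rw [this]; field_simp
      rw [h3]; push_cast; ring
    rw [h2, Complex.exp_add, Complex.exp_nat_mul_two_pi_mul_I, mul_one]
  have hinj : Set.InjOn (fun h => a * (h + 1) % q) (Finset.range (q - 1) : Set ℕ) := by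
    intro h hh h' hh' heq
    have h1 : a * (h + 1) ≡ a * (h' + 1) [MOD q] := heq
    have h2 : h + 1 ≡ h' + 1 [MOD q] := Nat.ModEq.cancel_left_of_coprime haq.symm h1
    simp only [Finset.coe_range, Set.mem_Iio] at hh hh'
    have := Nat.ModEq.eq_of_lt_of_lt h2 (by omega) (by omega)
    omega
  have hsub : (Finset.range (q - 1)).image (fun h => a * (h + 1) % q) ⊆ Finset.Ico 1 q := by
    intro r hr
    obtain ⟨h, hh, rfl⟩ := Finset.mem_image.mp hr
    have hh := Finset.mem_range.mp hh
    refine Finset.mem_Ico.mpr ⟨Nat.pos_of_ne_zero fun h0 => ?_, Nat.mod_lt _ hq⟩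
    have h1 : q ∣ h + 1 := haq.symm.dvd_of_dvd_mul_left (Nat.dvd_of_mod_eq_zero h0)
    have := Nat.le_of_dvd (by omega) h1
    omega
  calc _ = ∑ h ∈ Finset.range (q - 1), g (a * (h + 1) % q) :=
        Finset.sum_congr rfl fun h _ => hmod _
    _ = ∑ r ∈ (Finset.range (q - 1)).image (fun h => a * (h + 1) % q), g r :=
        (Finset.sum_image hinj).symm
    _ ≤ ∑ r ∈ Finset.Ico 1 q, g r :=
        Finset.sum_le_sum_of_subset_of_nonneg hsub fun r _ _ => by positivity
    _ ≤ ∑ r ∈ Finset.Ico 1 q, q / 4 * (1 / r + 1 / ((q - r : ℕ) : ℝ)) :=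
        Finset.sum_le_sum fun r hr => inv_norm_exp_sub_one_le (Finset.mem_Ico.mp hr).1
          (Finset.mem_Ico.mp hr).2
    _ = q / 4 * (∑ r ∈ Finset.range (q - 1), (1 : ℝ) / ((r + 1 : ℕ) : ℝ) +
          ∑ r ∈ Finset.range (q - 1), (1 : ℝ) / ((r + 1 : ℕ) : ℝ)) := by
        rw [← Finset.mul_sum, Finset.sum_add_distrib, Finset.sum_Ico_eq_sum_range,
          Finset.sum_Ico_eq_sum_range]
        congr 2
        · exact Finset.sum_congr rfl fun r _ => by rw [add_comm]
        · rw [← Finset.sum_range_reflect]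
          refine Finset.sum_congr rfl fun r hr => ?_
          have := Finset.mem_range.mp hr
          congr 2
          omega
    _ ≤ q / 4 * ((1 + Real.log q) + (1 + Real.log q)) := by
        gcongr <;> exact sum_inv_range_le_one_add_log q
    _ = _ := by ring

/-- Weyl's bound for the quadratic exponential sum of length `q` with leading coefficient
`π a / q`. -/
theorem norm_sq_quadratic_sum_le {a q : ℕ} (hq : 1 ≤ q) (haq : Nat.Coprime a q) (x : ℝ) :
    ‖∑ k ∈ Finset.range q,
      Complex.exp (Complex.I * ((k * x + Real.pi * a / q * k ^ 2 : ℝ) : ℂ))‖ ^ 2 ≤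
      3 * q * (1 + Real.log q) := by
  set u : ℕ → ℂ := fun k => Complex.exp (Complex.I * ((k * x + Real.pi * a / q * k ^ 2 : ℝ) : ℂ))
  have hu : ∀ k, ‖u k‖ = 1 := fun k => by
    simp only [u]; rw [mul_comm, Complex.norm_exp_ofReal_mul_I]
  have hlog : 0 ≤ Real.log q := Real.log_natCast_nonneg q
  have hqR : (q : ℝ) ≠ 0 := by positivity
  -- Differencing makes the phase linear in `l`. The coefficient `πa/q` doubles to `2πa/q`, so the
  -- inner sums are geometric with a `q`-th root of unity as ratio, whatever the linear coefficient
  -- `x` is.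
  have hcorr : ∀ h l : ℕ, u (l + h) * (starRingEnd ℂ) (u l) = u h *
      Complex.exp (Complex.I * ((2 * Real.pi * (a * h : ℕ) / q : ℝ) : ℂ)) ^ l := by
    intro h l
    simp only [u]
    rw [← Complex.exp_conj, map_mul, Complex.conj_I, Complex.conj_ofReal, ← Complex.exp_add,
      ← Complex.exp_nat_mul, ← Complex.exp_add]
    congr 1
    push_cast
    ring
  have hsq : ‖∑ k ∈ Finset.range q, u k‖ ^ 2 =
      ‖∑ k ∈ Finset.range q, ∑ l ∈ Finset.range q, u k * (starRingEnd ℂ) (u l)‖ := by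
    rw [← Finset.sum_mul_sum, norm_mul, ← map_sum, RCLike.norm_conj, sq]
  rw [hsq, sum_range_sum_range_eq_diagonals]
  have hdiag : ‖∑ k ∈ Finset.range q, u k * (starRingEnd ℂ) (u k)‖ ≤ q := by
    refine (norm_sum_le _ _).trans ?_
    simp [hu]
  have hoff : ∀ h ∈ Finset.range (q - 1), ‖∑ l ∈ Finset.range (q - (h + 1)),
      (u (l + (h + 1)) * (starRingEnd ℂ) (u l) + u l * (starRingEnd ℂ) (u (l + (h + 1))))‖ ≤
      4 * (1 / ‖Complex.exp (Complex.I * ((2 * Real.pi * (a * (h + 1) : ℕ) / q : ℝ) : ℂ)) - 1‖) := by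
    intro h hh
    have hh := Finset.mem_range.mp hh
    set w := Complex.exp (Complex.I * ((2 * Real.pi * (a * (h + 1) : ℕ) / q : ℝ) : ℂ)) with hw
    have hw1 : w ≠ 1 := by
      intro h1
      rw [hw, Complex.exp_eq_one_iff] at h1
      obtain ⟨c, hc⟩ := h1
      have h2 : ((a * (h + 1) : ℕ) : ℂ) = c * q := by
        have hpi : (Real.pi : ℂ) ≠ 0 := by exact_mod_cast Real.pi_ne_zero
        have hq' : (q : ℂ) ≠ 0 := by exact_mod_cast hqR
        have hI := Complex.I_ne_zero
        push_cast at hc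
        field_simp at hc
        push_cast
        linear_combination hc
      have h3 : ((a * (h + 1) : ℕ) : ℤ) = c * q := by exact_mod_cast h2
      have h4 : q ∣ a * (h + 1) := by
        rw [← Int.natCast_dvd_natCast, h3]; exact dvd_mul_left _ _
      have := Nat.le_of_dvd (by omega) (haq.symm.dvd_of_dvd_mul_left h4)
      omega
    have hA : ‖∑ l ∈ Finset.range (q - (h + 1)), u (l + (h + 1)) * (starRingEnd ℂ) (u l)‖ ≤
        2 / ‖w - 1‖ := by
      simp only [hcorr]
      rw [← Finset.mul_sum, norm_mul, hu, one_mul]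
      exact norm_geom_sum_le (by rw [hw, mul_comm, Complex.norm_exp_ofReal_mul_I]) hw1 _
    have hB : ‖∑ l ∈ Finset.range (q - (h + 1)), u l * (starRingEnd ℂ) (u (l + (h + 1)))‖ ≤
        2 / ‖w - 1‖ := by
      rw [← RCLike.norm_conj, map_sum]
      simpa [mul_comm] using hA
    rw [Finset.sum_add_distrib]
    refine (norm_add_le _ _).trans ((add_le_add hA hB).trans (le_of_eq ?_))
    ring
  obtain ⟨q', rfl⟩ : ∃ q', q = q' + 1 := ⟨q - 1, by omega⟩
  -- The last difference, `h + 1 = q`, has an empty inner sum; dropping it avoids the ratio `1`.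
  have hlast : ∑ h ∈ Finset.range (q' + 1), ∑ l ∈ Finset.range (q' + 1 - (h + 1)),
      (u (l + (h + 1)) * (starRingEnd ℂ) (u l) + u l * (starRingEnd ℂ) (u (l + (h + 1)))) =
      ∑ h ∈ Finset.range q', ∑ l ∈ Finset.range (q' + 1 - (h + 1)),
      (u (l + (h + 1)) * (starRingEnd ℂ) (u l) + u l * (starRingEnd ℂ) (u (l + (h + 1)))) := by
    rw [Finset.sum_range_succ]; simp
  rw [hlast]
  have hsum := (norm_sum_le _ _).trans (Finset.sum_le_sum hoff)
  rw [← Finset.mul_sum, Nat.add_sub_cancel] at hsum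
  have hinv := sum_inv_norm_exp_sub_one_le hq haq
  rw [Nat.add_sub_cancel] at hinv
  refine (norm_add_le _ _).trans ?_
  have h0 : (0 : ℝ) ≤ ((q' + 1 : ℕ) : ℝ) := by positivity
  -- The diagonal contributes `q` and the rest `4 · (q/2)(1 + log q)`, which together are at most
  -- `3q(1 + log q)`.
  nlinarith [mul_nonneg h0 hlog]

/-! ### Gaussians, the focusing data and their Sobolev norm -/

/-- The squared Euclidean norm of a vector in `ℝⁿ`. -/
def sqSum {n : ℕ} (ξ : Fin n → ℝ) : ℝ := ∑ j, ξ j ^ 2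

theorem sqSum_nonneg {n : ℕ} (ξ : Fin n → ℝ) : 0 ≤ sqSum ξ := by unfold sqSum; positivity

theorem norm_sq_le_sqSum {n : ℕ} (ξ : Fin n → ℝ) : ‖ξ‖ ^ 2 ≤ sqSum ξ := by
  rw [← Real.le_sqrt (norm_nonneg _) (sqSum_nonneg ξ)]
  refine (pi_norm_le_iff_of_nonneg (Real.sqrt_nonneg _)).mpr fun j => ?_
  refine Real.le_sqrt_of_sq_le ?_
  rw [Real.norm_eq_abs, sq_abs]
  exact Finset.single_le_sum (f := fun j => ξ j ^ 2) (fun i _ => sq_nonneg _) (Finset.mem_univ j)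

theorem hasTemperateGrowth_sqSum (n : ℕ) :
    Function.HasTemperateGrowth (sqSum : (Fin n → ℝ) → ℝ) := by
  unfold sqSum
  refine Function.HasTemperateGrowth.sum fun j _ => ?_
  exact (ContinuousLinearMap.proj (R := ℝ) (φ := fun _ : Fin n => ℝ) j).hasTemperateGrowth.pow 2

/-- Factoring out `c^r` and rescaling by `√c` reduces this to the Japanese bracket `(1 + ‖x‖²)^r` on
Euclidean space. It makes the Bessel weight a multiplier of the Schwartz space. -/
theorem hasTemperateGrowth_add_sqSum_rpow (n : ℕ) {c : ℝ} (hc : 0 < c) (r : ℝ) :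
    Function.HasTemperateGrowth fun ξ : Fin n → ℝ => (((c + sqSum ξ) ^ r : ℝ) : ℂ) := by
  set L : (Fin n → ℝ) →L[ℝ] EuclideanSpace ℝ (Fin n) :=
    (Real.sqrt c)⁻¹ • ((EuclideanSpace.equiv (Fin n) ℝ).symm : (Fin n → ℝ) →L[ℝ] _)
  have h1 := (Function.hasTemperateGrowth_one_add_norm_sq_rpow
    (EuclideanSpace ℝ (Fin n)) r).comp L.hasTemperateGrowth
  have h2 := Function.Complex.hasTemperateGrowth_ofReal.comp
    ((Function.HasTemperateGrowth.const (E := Fin n → ℝ) (c ^ r : ℝ)).mul h1)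
  suffices h : (fun ξ : Fin n → ℝ => (((c + sqSum ξ) ^ r : ℝ) : ℂ)) = Complex.ofReal ∘
      ((fun _ => c ^ r) * (fun x => (1 + ‖x‖ ^ 2) ^ r) ∘ L) by
    rw [h]; exact h2
  funext ξ
  simp only [Function.comp_apply, Pi.mul_apply]
  have h3 : ‖L ξ‖ ^ 2 = c⁻¹ * sqSum ξ := by
    have : L ξ = (Real.sqrt c)⁻¹ • WithLp.toLp 2 ξ := rfl
    rw [this, norm_smul, mul_pow, EuclideanSpace.norm_sq_eq, Real.norm_eq_abs, sq_abs, inv_pow,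
      Real.sq_sqrt hc.le]
    simp [sqSum]
  rw [h3, ← Real.mul_rpow hc.le (by have := sqSum_nonneg ξ; positivity)]
  congr 2
  field_simp

theorem iteratedFDeriv_cexp_mul_bound (b : ℂ) (j : ℕ) (s : ℝ) :
    ‖iteratedFDeriv ℝ j (fun s : ℝ => Complex.exp (-b * (s : ℂ))) s‖ =
      ‖b‖ ^ j * Real.exp (-b.re * s) := by
  rw [norm_iteratedFDeriv_eq_norm_iteratedDeriv]
  have h : ∀ j : ℕ, iteratedDeriv j (fun s : ℝ => Complex.exp (-b * (s : ℂ))) =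
      fun s : ℝ => (-b) ^ j * Complex.exp (-b * (s : ℂ)) := by
    intro j
    induction j with
    | zero => simp
    | succ j ih =>
      rw [iteratedDeriv_succ, ih]
      funext s
      have h1 : HasDerivAt (fun s : ℝ => -b * (s : ℂ)) (-b * 1) s :=
        (Complex.ofRealCLM.hasDerivAt (x := s)).const_mul _
      rw [(h1.cexp.const_mul _).deriv]
      ring
  rw [h]
  change ‖(-b) ^ j * Complex.exp (-b * (s : ℂ))‖ = _
  rw [norm_mul, norm_pow, norm_neg, Complex.norm_exp]
  simp

/-- The polynomial is at most `M! e^{1+y}`, and completing the square in `y - βy²` absorbs the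
remaining exponential. -/
theorem one_add_pow_mul_exp_le {β y : ℝ} (hβ : 0 < β) (hy : 0 ≤ y) (M : ℕ) :
    (1 + y) ^ M * Real.exp (-β * y ^ 2) ≤ M.factorial * Real.exp (1 + 1 / (4 * β)) := by
  have h1 := Real.pow_div_factorial_le_exp (1 + y) (by positivity) M
  rw [div_le_iff₀ (by positivity)] at h1
  have h2 : 1 + y + -β * y ^ 2 ≤ 1 + 1 / (4 * β) := by
    have : 1 / (4 * β) - (y - β * y ^ 2) = β * (y - 1 / (2 * β)) ^ 2 := by field_simp; ring
    have h3 : 0 ≤ β * (y - 1 / (2 * β)) ^ 2 := by positivity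
    linarith
  calc _ ≤ Real.exp (1 + y) * M.factorial * Real.exp (-β * y ^ 2) := by gcongr
    _ = M.factorial * Real.exp (1 + y + -β * y ^ 2) := by rw [Real.exp_add (1 + y)]; ring
    _ ≤ _ := by gcongr

/-- The Gaussian `ξ ↦ e^{-b|ξ|²}`, `Re b > 0`, as a Schwartz function on `ℝⁿ`. -/
noncomputable def gaussianSchwartz (n : ℕ) (b : ℂ) (hb : 0 < b.re) : 𝓢(Fin n → ℝ, ℂ) where
  toFun ξ := Complex.exp (-b * (sqSum ξ : ℂ))
  smooth' := (contDiff_const.mul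
    (Complex.ofRealCLM.contDiff.comp (hasTemperateGrowth_sqSum n).1)).cexp
  decay' l j := by
    obtain ⟨k, C, hC0, hC⟩ := (hasTemperateGrowth_sqSum n).norm_iteratedFDeriv_le_uniform j
    refine ⟨j.factorial * (1 + ‖b‖) ^ j * (1 + C) ^ j *
      ((l + k * j).factorial * Real.exp (1 + 1 / (4 * b.re))), fun ξ => ?_⟩
    have hg : ContDiff ℝ ((⊤ : ℕ∞) : WithTop ℕ∞) (fun s : ℝ => Complex.exp (-b * (s : ℂ))) :=
      (contDiff_const.mul Complex.ofRealCLM.contDiff).cexp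
    -- The Faà di Bruno bound. The constant for the inner function is taken to be at least `1`, so
    -- its first power already bounds every derivative of order `1 ≤ i ≤ j`.
    have h1 := norm_iteratedFDeriv_comp_le (n := j) hg (hasTemperateGrowth_sqSum n).1
      (by exact_mod_cast le_top) ξ (C := (1 + ‖b‖) ^ j * Real.exp (-b.re * ‖ξ‖ ^ 2))
      (D := (1 + C) * (1 + ‖ξ‖) ^ k) (fun i hi => by
        rw [iteratedFDeriv_cexp_mul_bound]
        refine mul_le_mul ?_ (Real.exp_le_exp.mpr ?_) (by positivity) (by positivity)
        · calc ‖b‖ ^ i ≤ (1 + ‖b‖) ^ i := by gcongr; linarith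
            _ ≤ _ := pow_le_pow_right₀ (by linarith [norm_nonneg b]) hi
        · have := norm_sq_le_sqSum ξ
          nlinarith)
      (fun i hi1 hi => by
        refine (hC i hi ξ).trans ?_
        have h2 : 1 ≤ (1 + ‖ξ‖) ^ k := one_le_pow₀ (by linarith [norm_nonneg ξ])
        have h3 : 1 ≤ (1 + C) * (1 + ‖ξ‖) ^ k := one_le_mul_of_one_le_of_one_le (by linarith) h2
        refine le_trans ?_ (le_self_pow₀ h3 (by omega))
        gcongr
        linarith)
    calc _ ≤ (1 + ‖ξ‖) ^ l * (j.factorial * ((1 + ‖b‖) ^ j * Real.exp (-b.re * ‖ξ‖ ^ 2)) *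
          ((1 + C) * (1 + ‖ξ‖) ^ k) ^ j) := by
          gcongr
          · linarith
          · exact h1
      _ = j.factorial * (1 + ‖b‖) ^ j * (1 + C) ^ j *
          ((1 + ‖ξ‖) ^ (l + k * j) * Real.exp (-b.re * ‖ξ‖ ^ 2)) := by
          rw [mul_pow, ← pow_mul, pow_add]; ring
      _ ≤ _ := by
          exact mul_le_mul_of_nonneg_left (one_add_pow_mul_exp_le hb (norm_nonneg _) _)
            (by positivity)

theorem gaussianSchwartz_apply {n : ℕ} {b : ℂ} (hb : 0 < b.re) (ξ : Fin n → ℝ) :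
    gaussianSchwartz n b hb ξ = Complex.exp (-b * (sqSum ξ : ℂ)) := rfl

/-- The complex parameter `ε - it` of the Gaussian `e^{-ε|ξ|²} e^{it|ξ|²}`. -/
noncomputable def gaussParam (ε t : ℝ) : ℂ := (ε : ℂ) - Complex.I * t

theorem gaussParam_re (ε t : ℝ) : (gaussParam ε t).re = ε := by simp [gaussParam]

theorem gaussParam_im (ε t : ℝ) : (gaussParam ε t).im = -t := by simp [gaussParam]

theorem freqSq_eq {m n : ℕ} (k : Fin m → ℤ) (ξ : Fin n → ℝ) :
    freqSq k ξ = sqSum (toRealVec k) + sqSum ξ := rfl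

/-- The Schwartz function `(1 + |k|² + |ξ|²)^{-α/2} e^{it(|k|² + |ξ|²)} e^{-ε|ξ|²}` of `ξ`. -/
noncomputable def focusFreq {m n : ℕ} (α t ε : ℝ) (hε : 0 < ε) (k : Fin m → ℤ) :
    𝓢(Fin n → ℝ, ℂ) :=
  Complex.exp (Complex.I * t * (sqSum (toRealVec k) : ℂ)) •
    SchwartzMap.smulLeftCLM ℂ
      (fun ξ => (((1 + sqSum (toRealVec k) + sqSum ξ) ^ (-(α / 2)) : ℝ) : ℂ))
      (gaussianSchwartz n (gaussParam ε t) (by rwa [gaussParam_re]))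

theorem focusFreq_apply {m n : ℕ} (α t ε : ℝ) (hε : 0 < ε) (k : Fin m → ℤ) (ξ : Fin n → ℝ) :
    focusFreq α t ε hε k ξ = (((1 + freqSq k ξ) ^ (-(α / 2)) * Real.exp (-ε * sqSum ξ) : ℝ) : ℂ) *
      Complex.exp (Complex.I * ((t * freqSq k ξ : ℝ) : ℂ)) := by
  have hc : 0 < 1 + sqSum (toRealVec k) := by have := sqSum_nonneg (toRealVec k); positivity
  rw [focusFreq, smul_apply,
    SchwartzMap.smulLeftCLM_apply_apply (hasTemperateGrowth_add_sqSum_rpow n hc _),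
    gaussianSchwartz_apply, freqSq_eq, ← add_assoc, smul_eq_mul, smul_eq_mul, mul_left_comm,
    ← Complex.exp_add, Complex.ofReal_mul, Complex.ofReal_exp,
    mul_assoc _ (Complex.exp _) (Complex.exp _), ← Complex.exp_add]
  congr 2
  simp only [gaussParam]
  push_cast
  ring

/-- Initial data focusing at the origin at time `t`. -/
noncomputable def focusWave (m n : ℕ) (α t : ℝ) (N : ℕ) (ε : ℝ) (hε : 0 < ε) : Cyl m n → ℂ :=
  waveSum (latticeCube m N) (focusFreq α t ε hε)

theorem schrodinger_focusWave {m n : ℕ} (α t₀ : ℝ) (N : ℕ) (ε : ℝ) (hε : 0 < ε) (t : ℝ)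
    (z : Cyl m n) :
    schrodinger t (focusWave m n α t₀ N ε hε) z = ∑ k ∈ latticeCube m N, ∫ ξ,
      (((1 + freqSq k ξ) ^ (-(α / 2)) * Real.exp (-ε * sqSum ξ) : ℝ) : ℂ) *
        Complex.exp (Complex.I * ((cylPhase k ξ z - (t - t₀) * freqSq k ξ : ℝ) : ℂ)) := by
  rw [schrodinger, focusWave, cylMultiplier_waveSum]
  refine Finset.sum_congr rfl fun k _ => ?_
  congr 1; funext ξ
  rw [focusFreq_apply, mul_left_comm, mul_assoc, ← Complex.exp_add, ← Complex.exp_add]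
  congr 2
  push_cast
  ring

theorem sum_latticeCube_prod (m N : ℕ) (u : Fin m → ℕ → ℂ) :
    ∑ k ∈ latticeCube m N, ∏ i, u i (k i).toNat = ∏ i, ∑ j ∈ Finset.range N, u i j := by
  have h : ∀ i, ∑ j ∈ Finset.range N, u i j = ∑ j ∈ Finset.Ico 0 (N : ℤ), u i j.toNat := by
    intro i
    refine Finset.sum_nbij' (fun j => (j : ℤ)) (fun j => j.toNat) ?_ ?_ ?_ ?_ ?_
    · intro j hj; simpa using hj
    · intro j hj
      have := Finset.mem_Ico.mp hj
      exact Finset.mem_range.mpr (by omega)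
    · intro j _; simp
    · intro j hj
      exact Int.toNat_of_nonneg (Finset.mem_Ico.mp hj).1
    · intro j _; simp
  simp only [h]
  rw [Finset.prod_univ_sum]
  rfl

/-- The Bessel potential cancels the weight in the data. What remains factorizes into one quadratic
exponential sum per torus coordinate and an explicit Gaussian integral. -/
theorem besselPotential_focusWave {m n : ℕ} (α t : ℝ) (N : ℕ) (ε : ℝ) (hε : 0 < ε)
    (z : Cyl m n) :
    besselPotential α (focusWave m n α t N ε hε) z =
      (∏ i, ∑ j ∈ Finset.range N,
        Complex.exp (Complex.I * ((j * z.1 i + t * j ^ 2 : ℝ) : ℂ))) *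
      (((Real.pi : ℂ) / gaussParam ε t) ^ ((n : ℂ) / 2) *
        Complex.exp (-(sqSum z.2 : ℂ) / (4 * gaussParam ε t))) := by
  have hb : 0 < (gaussParam ε t).re := by rwa [gaussParam_re]
  have hterm : ∀ k ∈ latticeCube m N, ∀ ξ : Fin n → ℝ,
      ((((1 + freqSq k ξ) ^ (α / 2) : ℝ)) : ℂ) * focusFreq α t ε hε k ξ *
        Complex.exp (Complex.I * (cylPhase k ξ z : ℂ)) =
      (∏ i, Complex.exp (Complex.I * (((k i).toNat * z.1 i + t * ((k i).toNat : ℝ) ^ 2 : ℝ) : ℂ))) *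
        Complex.exp (-gaussParam ε t * ∑ j, (ξ j : ℂ) ^ 2 + ∑ j, (Complex.I * z.2 j) * ξ j) := by
    intro k hk ξ
    have hs : 0 < 1 + freqSq k ξ := by have := freqSq_nonneg k ξ; positivity
    -- The cube `latticeCube` has nonnegative coordinates, so passing to natural numbers loses
    -- nothing.
    have hnat : ∀ i, (((k i).toNat : ℕ) : ℝ) = (k i : ℝ) := by
      intro i
      have h := (Finset.mem_Ico.mp (Fintype.mem_piFinset.mp hk i)).1
      exact_mod_cast Int.toNat_of_nonneg h
    have hw : (1 + freqSq k ξ) ^ (α / 2) * ((1 + freqSq k ξ) ^ (-(α / 2)) *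
        Real.exp (-ε * sqSum ξ)) = Real.exp (-ε * sqSum ξ) := by
      rw [← mul_assoc, ← Real.rpow_add hs, add_neg_cancel, Real.rpow_zero, one_mul]
    rw [focusFreq_apply, ← mul_assoc, ← Complex.ofReal_mul, hw, ← Complex.exp_sum,
      ← Complex.exp_add, Complex.ofReal_exp, ← Complex.exp_add, ← Complex.exp_add]
    congr 1
    simp only [hnat, cylPhase, freqSq, sqSum, gaussParam]
    push_cast
    simp only [mul_add, Finset.sum_add_distrib, Finset.mul_sum]
    have e1 : ∀ j : Fin n, Complex.I * ↑(z.2 j) * ↑(ξ j) = Complex.I * (↑(ξ j) * ↑(z.2 j)) :=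
      fun j => by ring
    simp only [e1, neg_sub, sub_mul, Finset.sum_sub_distrib, neg_mul, mul_assoc,
      Finset.sum_neg_distrib]
    ring
  rw [besselPotential, focusWave, cylMultiplier_waveSum]
  rw [Finset.sum_congr rfl fun k hk => integral_congr_ae
    (Filter.Eventually.of_forall fun ξ => hterm k hk ξ)]
  simp only [integral_const_mul]
  rw [← Finset.sum_mul, GaussianFourier.integral_cexp_neg_mul_sum_add hb, Fintype.card_fin,
    sum_latticeCube_prod m N (fun i j => Complex.exp (Complex.I *
      ((j * z.1 i + t * j ^ 2 : ℝ) : ℂ)))]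
  congr 3
  simp [sqSum, mul_pow]

theorem sqSum_smul {n : ℕ} (c : ℝ) (ξ : Fin n → ℝ) : sqSum (c • ξ) = c ^ 2 * sqSum ξ := by
  simp [sqSum, mul_pow, Finset.mul_sum]

/-- The profile `e^{-|y|²/8}`. -/
noncomputable def gaussProfile (n : ℕ) : 𝓢(Fin n → ℝ, ℂ) :=
  gaussianSchwartz n ((1 / 8 : ℝ) : ℂ) (by rw [Complex.ofReal_re]; norm_num)

theorem norm_gaussProfile {n : ℕ} (y : Fin n → ℝ) :
    ‖gaussProfile n y‖ = Real.exp (-(1 / 8) * sqSum y) := by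
  rw [gaussProfile, gaussianSchwartz_apply, ← Complex.ofReal_neg, ← Complex.ofReal_mul,
    Complex.norm_exp_ofReal]

/-- Dispersion: for times bounded away from `0` the height `(π/|ε - it|)^(n/2)` is bounded, and `Re
1/(ε - it) = ε/(ε² + t²) ≥ ε/2` spreads the Gaussian over `|y| ≲ ε^(-1/2)`. -/
theorem norm_gaussian_factor_le {n : ℕ} {ε t : ℝ} (hε : 0 < ε) (hε1 : ε ≤ 1)
    (ht : Real.pi / 5 ≤ t) (ht1 : t ≤ 1) (y : Fin n → ℝ) :
    ‖((Real.pi : ℂ) / gaussParam ε t) ^ ((n : ℂ) / 2) *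
        Complex.exp (-(sqSum y : ℂ) / (4 * gaussParam ε t))‖ ≤
      5 ^ n * Real.exp (-(1 / 8) * (ε * sqSum y)) := by
  have hpi := Real.pi_pos
  have ht0 : 0 < t := by linarith [div_pos hpi (by norm_num : (0 : ℝ) < 5)]
  have hb : t ≤ ‖gaussParam ε t‖ := by
    have := Complex.abs_im_le_norm (gaussParam ε t)
    rwa [gaussParam_im, abs_neg, abs_of_pos ht0] at this
  rw [norm_mul]
  refine mul_le_mul ?_ ?_ (norm_nonneg _) (by positivity)
  · have h1 : ((n : ℂ) / 2) = ((n / 2 : ℝ) : ℂ) := by push_cast; rfl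
    rw [h1, Complex.norm_cpow_real, norm_div, Complex.norm_real, Real.norm_of_nonneg hpi.le]
    have h2 : Real.pi / ‖gaussParam ε t‖ ≤ 5 := by
      rw [div_le_iff₀ (ht0.trans_le hb)]; linarith
    calc (Real.pi / ‖gaussParam ε t‖) ^ ((n : ℝ) / 2) ≤ 5 ^ ((n : ℝ) / 2) := by gcongr
      _ ≤ 5 ^ (n : ℝ) := by
        refine Real.rpow_le_rpow_of_exponent_le (by norm_num) ?_
        have : (0 : ℝ) ≤ n := by positivity
        linarith
      _ = 5 ^ n := Real.rpow_natCast _ _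
  · rw [Complex.norm_exp]
    refine Real.exp_le_exp.mpr ?_
    have hS := sqSum_nonneg y
    have h1 : (-(sqSum y : ℂ) / (4 * gaussParam ε t)) =
        ((-(sqSum y) / 4 : ℝ) : ℂ) * (gaussParam ε t)⁻¹ := by
      push_cast; rw [div_eq_mul_inv, mul_inv]; ring
    have hns : Complex.normSq (gaussParam ε t) = ε ^ 2 + t ^ 2 := by
      rw [Complex.normSq_apply, gaussParam_re, gaussParam_im]; ring
    rw [h1, Complex.re_ofReal_mul, Complex.inv_re, gaussParam_re, hns]
    have h2 : ε / 2 ≤ ε / (ε ^ 2 + t ^ 2) := by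
      gcongr; nlinarith
    nlinarith

/-- The choice `N = 4a + 1` makes `a` coprime to `N`, as Weyl's bound requires, and places `πa/N`
between `π/5` and `π/4`, so that it is bounded below and stays inside the time interval. -/
theorem norm_besselPotential_focusWave_le {m n : ℕ} {a N : ℕ} (ha : 1 ≤ a) (hN : N = 4 * a + 1)
    (α : ℝ) (hε : 0 < ((N : ℝ) ^ 2)⁻¹) (z : Cyl m n) :
    ‖besselPotential α (focusWave m n α (Real.pi * a / N) N ((N : ℝ) ^ 2)⁻¹ hε) z‖ ≤
      Real.sqrt (3 * N * (1 + Real.log N)) ^ m * 5 ^ n *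
        ‖gaussProfile n ((N : ℝ)⁻¹ • z.2)‖ := by
  have hN1 : (1 : ℝ) ≤ N := by rw [hN]; push_cast; linarith [(Nat.cast_nonneg a : (0 : ℝ) ≤ a)]
  have haR : (1 : ℝ) ≤ a := by exact_mod_cast ha
  have hNa : (N : ℝ) = 4 * a + 1 := by rw [hN]; push_cast; ring
  have hcop : Nat.Coprime a N := by
    rw [hN]; simp
  have hpi := Real.pi_pos
  rw [besselPotential_focusWave, norm_mul, norm_prod, mul_assoc]
  refine mul_le_mul ?_ ?_ (norm_nonneg _) (by positivity)
  · calc _ ≤ ∏ _i : Fin m, Real.sqrt (3 * N * (1 + Real.log N)) :=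
        Finset.prod_le_prod (fun _ _ => norm_nonneg _) fun i _ =>
          Real.le_sqrt_of_sq_le (norm_sq_quadratic_sum_le (by omega) hcop (z.1 i))
      _ = _ := by simp
  · rw [norm_gaussProfile, sqSum_smul, inv_pow]
    refine norm_gaussian_factor_le hε (inv_le_one_of_one_le₀ (by nlinarith)) ?_ ?_ z.2
    · rw [hNa, div_le_div_iff₀ (by norm_num) (by positivity)]
      nlinarith
    · rw [hNa, div_le_one (by positivity)]
      nlinarith [Real.pi_lt_four]

theorem eLpNorm_snd_comp_inv_smul (m : ℕ) {n : ℕ} (h : 𝓢(Fin n → ℝ, ℂ)) (p : ℝ≥0∞) {R : ℝ}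
    (hR : 0 < R) :
    eLpNorm (fun z : Cyl m n => h (R⁻¹ • z.2)) p (cylMeasure m n) =
      ENNReal.ofReal (R ^ n) ^ (p⁻¹).toReal *
        eLpNorm (fun z : Cyl m n => h z.2) p (cylMeasure m n) := by
  have hmap : Measure.map (Prod.map id (fun y => R⁻¹ • y)) (cylMeasure m n) =
      ENNReal.ofReal (R ^ n) • cylMeasure m n := by
    rw [cylMeasure, ← Measure.map_prod_map _ _ measurable_id (measurable_const_smul R⁻¹),
      Measure.map_id, Measure.map_addHaar_smul _ (inv_ne_zero hR.ne'), Module.finrank_fin_fun,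
      inv_pow, inv_inv, abs_of_pos (by positivity), Measure.prod_smul_right]
  have hmeas : AEMeasurable (Prod.map id (fun y : Fin n → ℝ => R⁻¹ • y)) (cylMeasure m n) :=
    (measurable_id.prodMap (measurable_const_smul R⁻¹)).aemeasurable
  have h1 := eLpNorm_map_measure (p := p) (g := fun z : Cyl m n => h z.2)
    ((h.continuous.comp continuous_snd).aestronglyMeasurable) hmeas
  rw [hmap, eLpNorm_smul_measure_of_ne_zero (ENNReal.ofReal_pos.mpr (by positivity)).ne'] at h1
  rw [smul_eq_mul, one_div] at h1
  exact h1.symm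

theorem sobolevNorm_focusWave_le {m n : ℕ} {a N : ℕ} (ha : 1 ≤ a) (hN : N = 4 * a + 1)
    (α : ℝ) (p : ℝ≥0∞) (hε : 0 < ((N : ℝ) ^ 2)⁻¹) :
    sobolevNorm α p (focusWave m n α (Real.pi * a / N) N ((N : ℝ) ^ 2)⁻¹ hε) ≤
      ENNReal.ofReal (Real.sqrt (3 * N * (1 + Real.log N)) ^ m * 5 ^ n) *
        (ENNReal.ofReal ((N : ℝ) ^ n) ^ (p⁻¹).toReal *
          eLpNorm (fun z : Cyl m n => gaussProfile n z.2) p (cylMeasure m n)) := by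
  rw [← eLpNorm_snd_comp_inv_smul m (gaussProfile n) p (by rw [hN]; positivity : (0 : ℝ) < N)]
  exact eLpNorm_le_mul_eLpNorm_of_ae_le_mul (Filter.Eventually.of_forall fun z =>
    norm_besselPotential_focusWave_le ha hN α hε z) p

/-! ### Size of the solution near the focus -/

/-- A bound valid for all `θ` and only linear in `|θ|`: it controls the Gaussian tail, where the
phase is not small, by a small multiple of an integrable function. -/
theorem one_sub_abs_le_cos (θ : ℝ) : 1 - |θ| ≤ Real.cos θ := by
  rcases le_total |θ| 2 with h | h
  · have h1 := Real.one_sub_sq_div_two_le_cos (x := θ)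
    have h2 : θ ^ 2 = |θ| ^ 2 := (sq_abs θ).symm
    nlinarith [abs_nonneg θ]
  · linarith [Real.neg_one_le_cos θ]

/-- Near the focus the phase varies slowly on the bulk of the frequency support. -/
theorem abs_focus_phase_le {m n : ℕ} (hm : 1 ≤ m) {N : ℕ} (hN : 1 ≤ N) {k : Fin m → ℤ}
    (hk : k ∈ latticeCube m N) (ξ : Fin n → ℝ) {δ s : ℝ} (hδ : 0 ≤ δ) (hs0 : 0 ≤ s)
    (hs : s ≤ δ / N ^ 2) {z : Cyl m n} (hx : ∀ i, |z.1 i| ≤ δ / N) (hy : ∀ j, |z.2 j| ≤ δ / N) :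
    |cylPhase k ξ z - s * freqSq k ξ| ≤
      2 * (m + n) * δ * (1 + sqSum ((N : ℝ)⁻¹ • ξ)) := by
  have hN0 : (0 : ℝ) < N := by exact_mod_cast hN
  have hmR : (1 : ℝ) ≤ m := by exact_mod_cast hm
  have hkN : ∀ i, |(k i : ℝ)| ≤ N := fun i => (abs_le_of_mem_latticeCube hk i).trans (by linarith)
  set R := sqSum ((N : ℝ)⁻¹ • ξ) with hR
  have hR0 : 0 ≤ R := sqSum_nonneg _
  have hRξ : sqSum ξ = (N : ℝ) ^ 2 * R := by rw [hR, sqSum_smul]; field_simp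
  have h1 : |∑ i, (k i : ℝ) * z.1 i| ≤ m * δ := by
    refine (Finset.abs_sum_le_sum_abs _ _).trans ?_
    calc _ ≤ ∑ _i : Fin m, (N : ℝ) * (δ / N) := Finset.sum_le_sum fun i _ => by
          rw [abs_mul]
          exact mul_le_mul (hkN i) (hx i) (abs_nonneg _) hN0.le
      _ = m * δ := by
          rw [Finset.sum_const, Finset.card_univ, Fintype.card_fin, nsmul_eq_mul]; field_simp
  have h2 : |∑ j, ξ j * z.2 j| ≤ δ * (n + R) := by
    refine (Finset.abs_sum_le_sum_abs _ _).trans ?_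
    calc _ ≤ ∑ j : Fin n, δ * (1 + ((N : ℝ)⁻¹ * ξ j) ^ 2) := Finset.sum_le_sum fun j _ => by
          rw [abs_mul]
          have e1 : |ξ j| * |z.2 j| ≤ |ξ j| * (δ / N) :=
            mul_le_mul_of_nonneg_left (hy j) (abs_nonneg _)
          have e2 : |ξ j| * (δ / N) = δ * |(N : ℝ)⁻¹ * ξ j| := by
            rw [abs_mul, abs_of_pos (inv_pos.mpr hN0)]; field_simp
          have e3 : |(N : ℝ)⁻¹ * ξ j| ≤ 1 + ((N : ℝ)⁻¹ * ξ j) ^ 2 := by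
            rw [← sq_abs]; nlinarith [sq_nonneg (|(N : ℝ)⁻¹ * ξ j| - 1)]
          rw [e2] at e1
          exact e1.trans (mul_le_mul_of_nonneg_left e3 hδ)
      _ = δ * (n + R) := by
          rw [← Finset.mul_sum, Finset.sum_add_distrib]
          simp [hR, sqSum]
  have h3 : freqSq k ξ ≤ N ^ 2 * (m + R) := by
    rw [freqSq_eq, hRξ, mul_add]
    have := freqSq_le (ξ := (0 : Fin 0 → ℝ)) hkN (fun j => j.elim0)
    simp only [freqSq, Finset.univ_eq_empty, Finset.sum_empty, add_zero, Nat.cast_zero] at this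
    have h4 : sqSum (toRealVec k) = ∑ i, (k i : ℝ) ^ 2 := rfl
    rw [h4]; linarith
  have h4 : s * freqSq k ξ ≤ δ * (m + R) := by
    calc _ ≤ δ / N ^ 2 * (N ^ 2 * (m + R)) :=
          mul_le_mul hs h3 (freqSq_nonneg k ξ) (by positivity)
      _ = _ := by field_simp
  have h5 : 0 ≤ s * freqSq k ξ := mul_nonneg hs0 (freqSq_nonneg k ξ)
  have h6 : |cylPhase k ξ z - s * freqSq k ξ| ≤ m * δ + δ * (n + R) + δ * (m + R) := by
    refine (abs_sub _ _).trans ?_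
    rw [abs_of_nonneg h5]
    have := (abs_add_le (∑ i, (k i : ℝ) * z.1 i) (∑ j, ξ j * z.2 j))
    have h7 : |cylPhase k ξ z| ≤ m * δ + δ * (n + R) := this.trans (by linarith)
    linarith
  refine h6.trans ?_
  have hn0 : (0 : ℝ) ≤ n := by positivity
  have h8 : δ * R ≤ (m + n) * (δ * R) := by
    have : 0 ≤ δ * R := by positivity
    nlinarith
  nlinarith [mul_nonneg hn0 hδ]

theorem sqSum_le_one_of_mem_cube {n : ℕ} (hn : 1 ≤ n) {η : Fin n → ℝ}
    (hη : η ∈ Set.Icc (0 : Fin n → ℝ) (fun _ => 1 / (n : ℝ))) : sqSum η ≤ 1 := by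
  have hnR : (1 : ℝ) ≤ n := by exact_mod_cast hn
  have h := freqSq_le (k := (0 : Fin 0 → ℤ)) (fun i => i.elim0) (abs_le_of_mem_cube hη)
  simp only [freqSq, Finset.univ_eq_empty, Finset.sum_empty, zero_add, Nat.cast_zero] at h
  refine (show sqSum η = ∑ j, η j ^ 2 from rfl).trans_le (h.trans ?_)
  rw [div_pow, one_pow, ← mul_div_assoc, mul_one, div_le_one (by positivity)]
  nlinarith

/-- Half of the exponential decay pays for the growth of the phase. -/
theorem one_add_mul_exp_neg_le {R : ℝ} : (1 + R) * Real.exp (-R) ≤ 2 * Real.exp (-(1 / 2) * R) := by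
  have h1 := Real.add_one_le_exp (R / 2)
  have h2 : Real.exp (-(1 / 2) * R) = Real.exp (R / 2) * Real.exp (-R) := by
    rw [← Real.exp_add]; ring_nf
  rw [h2, ← mul_assoc]
  gcongr
  linarith

/-- Pointwise lower bound for the oscillating weight of `focusWave`: on the bulk of the
frequency support the phase is harmless, and elsewhere the weight is small. -/
theorem focus_weight_mul_cos_ge {m n : ℕ} (hn : 1 ≤ n) {N : ℕ} (hN : 1 ≤ N)
    {k : Fin m → ℤ} (hk : k ∈ latticeCube m N) (ξ : Fin n → ℝ) {α δ θ : ℝ} (hα : 0 ≤ α)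
    (hδ0 : 0 ≤ δ) (hδ : δ ≤ 1 / 4) (hθ : |θ| ≤ δ * (1 + sqSum ((N : ℝ)⁻¹ • ξ))) :
    (N : ℝ) ^ (-α) * ((Set.Icc (0 : Fin n → ℝ) (fun _ => 1 / (n : ℝ))).indicator
        (fun _ => 1 / 2 * ((m : ℝ) + 2) ^ (-(α / 2)) * Real.exp (-1)) ((N : ℝ)⁻¹ • ξ) -
        2 * δ * Real.exp (-(1 / 2) * sqSum ((N : ℝ)⁻¹ • ξ))) ≤
      (1 + freqSq k ξ) ^ (-(α / 2)) * Real.exp (-((N : ℝ) ^ 2)⁻¹ * sqSum ξ) * Real.cos θ := by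
  have hN1 : (1 : ℝ) ≤ N := by exact_mod_cast hN
  have hN0 : (0 : ℝ) < N := by linarith
  set R := sqSum ((N : ℝ)⁻¹ • ξ) with hR
  have hR0 : 0 ≤ R := sqSum_nonneg _
  have hRξ : sqSum ξ = (N : ℝ) ^ 2 * R := by rw [hR, sqSum_smul]; field_simp
  have hexp : -((N : ℝ) ^ 2)⁻¹ * sqSum ξ = -R := by rw [hRξ]; field_simp
  rw [hexp]
  have hcos := one_sub_abs_le_cos θ
  have hNα : (N : ℝ) ^ (-α) = ((N : ℝ) ^ 2) ^ (-(α / 2)) := by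
    rw [← Real.rpow_natCast, ← Real.rpow_mul hN0.le]; congr 1; push_cast; ring
  have hNp : 0 < (N : ℝ) ^ (-α) := Real.rpow_pos_of_pos hN0 _
  have hs0 := freqSq_nonneg k ξ
  have hsξ : (N : ℝ) ^ 2 * R ≤ freqSq k ξ := by
    rw [freqSq_eq, hRξ]; linarith [sqSum_nonneg (toRealVec k)]
  -- For `R ≤ 1` the phase is at most `2δ ≤ 1/2`, so the cosine is at least `1/2`, and the weight is
  -- at least a constant times `N^(-α)`. For `R > 1` the cosine may be negative, but not below `-δ(1
  -- + R)`, and `freqSq ≥ N²` bounds the Bessel weight above by `N^(-α)`.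
  rcases le_or_gt R 1 with h1 | h1
  · have hs : 1 + freqSq k ξ ≤ ((m : ℝ) + 2) * (N : ℝ) ^ 2 := by
      have hkN : ∀ i, |(k i : ℝ)| ≤ N :=
        fun i => (abs_le_of_mem_latticeCube hk i).trans (by linarith)
      have := freqSq_le (ξ := (0 : Fin 0 → ℝ)) hkN (fun j => j.elim0)
      simp only [freqSq, Finset.univ_eq_empty, Finset.sum_empty, add_zero, Nat.cast_zero] at this
      have h4 : sqSum (toRealVec k) = ∑ i, (k i : ℝ) ^ 2 := rfl
      rw [freqSq_eq, hRξ, h4]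
      nlinarith
    have hw : ((m : ℝ) + 2) ^ (-(α / 2)) * (N : ℝ) ^ (-α) ≤ (1 + freqSq k ξ) ^ (-(α / 2)) := by
      rw [hNα, ← Real.mul_rpow (by positivity) (by positivity)]
      exact Real.rpow_le_rpow_of_nonpos (by positivity) hs (by linarith)
    have hc : 1 / 2 ≤ Real.cos θ := by nlinarith
    have he : Real.exp (-1) ≤ Real.exp (-R) := Real.exp_le_exp.mpr (by linarith)
    have hind : (Set.Icc (0 : Fin n → ℝ) (fun _ => 1 / (n : ℝ))).indicator
        (fun _ => 1 / 2 * ((m : ℝ) + 2) ^ (-(α / 2)) * Real.exp (-1)) ((N : ℝ)⁻¹ • ξ) ≤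
        1 / 2 * ((m : ℝ) + 2) ^ (-(α / 2)) * Real.exp (-1) :=
      Set.indicator_le_self' (fun _ _ => by positivity) _
    have hpos : 0 ≤ 2 * δ * Real.exp (-(1 / 2) * R) := by positivity
    calc _ ≤ (N : ℝ) ^ (-α) * (1 / 2 * ((m : ℝ) + 2) ^ (-(α / 2)) * Real.exp (-1)) := by
          refine mul_le_mul_of_nonneg_left ?_ hNp.le
          linarith
      _ = ((m : ℝ) + 2) ^ (-(α / 2)) * (N : ℝ) ^ (-α) * Real.exp (-1) * (1 / 2) := by ring
      _ ≤ _ := by gcongr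
  · have hnot : (N : ℝ)⁻¹ • ξ ∉ Set.Icc (0 : Fin n → ℝ) (fun _ => 1 / (n : ℝ)) := fun h =>
      absurd (sqSum_le_one_of_mem_cube hn h) (not_le.mpr h1)
    rw [Set.indicator_of_notMem hnot, zero_sub]
    have hw : (1 + freqSq k ξ) ^ (-(α / 2)) ≤ (N : ℝ) ^ (-α) := by
      rw [hNα]
      refine Real.rpow_le_rpow_of_nonpos (by positivity) ?_ (by linarith)
      nlinarith
    have hw0 : 0 ≤ (1 + freqSq k ξ) ^ (-(α / 2)) := by positivity
    have hc : -(δ * (1 + R)) ≤ Real.cos θ := by linarith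
    have hexp2 := one_add_mul_exp_neg_le (R := R)
    calc _ = -((N : ℝ) ^ (-α) * (δ * (2 * Real.exp (-(1 / 2) * R)))) := by ring
      _ ≤ -((1 + freqSq k ξ) ^ (-(α / 2)) * (δ * ((1 + R) * Real.exp (-R)))) := by
          gcongr
      _ = (1 + freqSq k ξ) ^ (-(α / 2)) * Real.exp (-R) * -(δ * (1 + R)) := by ring
      _ ≤ _ := by gcongr

theorem integrable_exp_neg_half_sqSum (n : ℕ) :
    Integrable fun η : Fin n → ℝ => Real.exp (-(1 / 2) * sqSum η) := by
  have h := (gaussianSchwartz n ((1 / 2 : ℝ) : ℂ)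
    (by rw [Complex.ofReal_re]; norm_num)).integrable (μ := volume) |>.norm
  refine h.congr (Filter.Eventually.of_forall fun η => ?_)
  simp only []
  rw [gaussianSchwartz_apply, ← Complex.ofReal_neg, ← Complex.ofReal_mul, Complex.norm_exp_ofReal]

theorem integrable_focus_weight {m n : ℕ} (α : ℝ) {ε : ℝ} (hε : 0 < ε) (k : Fin m → ℤ) :
    Integrable fun ξ : Fin n → ℝ =>
      (1 + freqSq k ξ) ^ (-(α / 2)) * Real.exp (-ε * sqSum ξ) := by
  have h := ((focusFreq α 0 ε hε k : 𝓢(Fin n → ℝ, ℂ)).integrable (μ := volume)).norm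
  refine h.congr (Filter.Eventually.of_forall fun ξ => ?_)
  have := freqSq_nonneg k ξ
  simp only []
  rw [focusFreq_apply, norm_mul, mul_comm Complex.I, Complex.norm_exp_ofReal_mul_I, mul_one,
    Complex.norm_real, Real.norm_of_nonneg (by positivity)]

/-- After the dilation `ξ = Nη`, each of the `N^m` torus frequencies contributes at least a constant
times `N^(n-α)`: a fixed main term from the bulk of the Gaussian minus a tail error proportional to
`δ`. The same `δ` works for all `N` and `t₀`. -/
theorem exists_le_norm_schrodinger_focusWave {m n : ℕ} (hm : 1 ≤ m) (hn : 1 ≤ n) {α : ℝ}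
    (hα : 0 ≤ α) : ∃ c > 0, ∃ δ > 0, δ ≤ 1 / 10 ∧ ∀ (N : ℕ), 1 ≤ N → ∀ (t₀ t : ℝ)
      (hε : 0 < ((N : ℝ) ^ 2)⁻¹) (z : Cyl m n), t₀ ≤ t → t ≤ t₀ + δ / N ^ 2 →
      (∀ i, |z.1 i| ≤ δ / N) → (∀ j, |z.2 j| ≤ δ / N) →
      c * (N : ℝ) ^ ((m : ℝ) + n - α) ≤
        ‖schrodinger t (focusWave m n α t₀ N ((N : ℝ) ^ 2)⁻¹ hε) z‖ := by
  set D : ℝ := (m : ℝ) + n with hD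
  have hD0 : 0 < D := by
    have : (1 : ℝ) ≤ m := by exact_mod_cast hm
    positivity
  set κ : ℝ := 1 / 2 * ((m : ℝ) + 2) ^ (-(α / 2)) * Real.exp (-1)
  have hκ : 0 < κ := by positivity
  set Q := Set.Icc (0 : Fin n → ℝ) (fun _ => 1 / (n : ℝ))
  set V : ℝ := (1 / (n : ℝ)) ^ n
  have hV : 0 < V := by positivity
  have hQ : ∫ η, Q.indicator (fun _ => κ) η = κ * V := by
    rw [integral_indicator_const _ measurableSet_Icc, smul_eq_mul, mul_comm]
    congr 1
    rw [measureReal_def, Real.volume_Icc_pi]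
    simp [V]
  set c₂ := ∫ η : Fin n → ℝ, Real.exp (-(1 / 2) * sqSum η)
  have hc₂ : 0 ≤ c₂ := integral_nonneg fun _ => (Real.exp_pos _).le
  -- The bound `1/10` later keeps the focusing window inside `[0, 1]`; the second makes the phase
  -- constant `2Dδ` at most `1/4`; the third makes the tail error at most half of the main term
  -- `κV`.
  set δ : ℝ := min (1 / 10) (min (1 / (8 * D)) (κ * V / (8 * D * (c₂ + 1))))
  have hδ0 : 0 < δ := by positivity
  have hδ1 : δ ≤ 1 / 10 := min_le_left _ _
  have hδ2 : 2 * D * δ ≤ 1 / 4 := by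
    have : δ ≤ 1 / (8 * D) := (min_le_right _ _).trans (min_le_left _ _)
    rw [le_div_iff₀ (by positivity)] at this
    linarith
  have hδ3 : 2 * (2 * D * δ) * c₂ ≤ κ * V / 2 := by
    have : δ ≤ κ * V / (8 * D * (c₂ + 1)) := (min_le_right _ _).trans (min_le_right _ _)
    rw [le_div_iff₀ (by positivity)] at this
    nlinarith [mul_pos hD0 hδ0]
  refine ⟨κ * V / 2, by positivity, δ, hδ0, hδ1, fun N hN t₀ t hε z ht1 ht2 hx hy => ?_⟩
  have hN0 : (0 : ℝ) < N := by exact_mod_cast hN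
  set ℓ : (Fin n → ℝ) → ℝ := fun η => Q.indicator (fun _ => κ) η -
    2 * (2 * D * δ) * Real.exp (-(1 / 2) * sqSum η) with hℓ
  have hindint : Integrable (Q.indicator (fun _ : Fin n → ℝ => κ)) :=
    (integrable_indicator_iff measurableSet_Icc).mpr
      (integrableOn_const isCompact_Icc.measure_lt_top.ne)
  have hℓint : Integrable ℓ :=
    hindint.sub ((integrable_exp_neg_half_sqSum n).const_mul _)
  have hℓval : κ * V / 2 ≤ ∫ η, ℓ η := by
    rw [hℓ, integral_sub hindint ((integrable_exp_neg_half_sqSum n).const_mul _), hQ,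
      integral_const_mul]
    linarith
  have hscale : ∫ ξ, (N : ℝ) ^ (-α) * ℓ ((N : ℝ)⁻¹ • ξ) =
      (N : ℝ) ^ (-α) * ((N : ℝ) ^ n * ∫ η, ℓ η) := by
    rw [integral_const_mul, Measure.integral_comp_inv_smul, Module.finrank_fin_fun,
      abs_of_pos (by positivity), smul_eq_mul]
  have hterm : ∀ k ∈ latticeCube m N, (N : ℝ) ^ (-α) * ((N : ℝ) ^ n * ∫ η, ℓ η) ≤
      ∫ ξ, (1 + freqSq k ξ) ^ (-(α / 2)) * Real.exp (-((N : ℝ) ^ 2)⁻¹ * sqSum ξ) *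
        Real.cos (cylPhase k ξ z - (t - t₀) * freqSq k ξ - 0) := by
    intro k hk
    rw [← hscale]
    refine integral_mono ((hℓint.comp_smul (inv_ne_zero hN0.ne')).const_mul _) ?_ fun ξ => ?_
    · refine (integrable_focus_weight α hε k).mul_bdd (c := 1) ?_ ?_
      · exact (Real.continuous_cos.comp (((continuous_cylPhase k z).sub
          (continuous_const.mul (continuous_freqSq k))).sub
          continuous_const)).aestronglyMeasurable
      · exact Filter.Eventually.of_forall fun y => Real.abs_cos_le_one _
    · refine focus_weight_mul_cos_ge hn hN hk ξ hα (by positivity) hδ2 ?_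
      rw [sub_zero]
      exact abs_focus_phase_le hm hN hk ξ hδ0.le (by linarith) (by linarith) hx hy
  rw [schrodinger_focusWave]
  refine le_trans ?_ (sum_integral_mul_cos_le_norm (latticeCube m N)
    (w := fun k ξ => (1 + freqSq k ξ) ^ (-(α / 2)) * Real.exp (-((N : ℝ) ^ 2)⁻¹ * sqSum ξ))
    (θ := fun k ξ => cylPhase k ξ z - (t - t₀) * freqSq k ξ) 0
    (fun k _ => integrable_focus_weight α hε k)
    (fun k _ => (continuous_cylPhase k z).sub (continuous_const.mul (continuous_freqSq k))))
  refine le_trans ?_ (Finset.sum_le_sum hterm)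
  rw [Finset.sum_const, card_latticeCube, nsmul_eq_mul, sub_eq_add_neg, Real.rpow_add hN0, hD,
    Real.rpow_add hN0, Real.rpow_natCast, Real.rpow_natCast]
  push_cast
  have hNp : 0 < (N : ℝ) ^ (-α) := Real.rpow_pos_of_pos hN0 _
  calc _ = (N : ℝ) ^ m * ((N : ℝ) ^ (-α) * ((N : ℝ) ^ n * (κ * V / 2))) := by ring
    _ ≤ _ := by gcongr

/-! ### Necessary condition on Sobolev spaces and conclusion -/

theorem le_mixedNorm {m n : ℕ} {q r : ℝ≥0∞} (hq : 1 ≤ q) (hr : 1 ≤ r) {f : Cyl m n → ℂ}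
    {ρ τ t₀ c : ℝ} (hρ0 : 0 < ρ) (hρ : ρ ≤ 1) (hτ0 : 0 < τ) (ht₀ : 0 ≤ t₀) (hτ : t₀ + τ ≤ 1)
    (h : ∀ z : Cyl m n, z ∈ Set.Icc (0 : Fin m → ℝ) (fun _ => ρ) ×ˢ
      Set.Icc (0 : Fin n → ℝ) (fun _ => ρ) → ∀ t ∈ Set.Icc t₀ (t₀ + τ),
      c ≤ ‖schrodinger t f z‖) :
    ENNReal.ofReal c * ENNReal.ofReal τ ^ (r⁻¹).toReal *
      ENNReal.ofReal (ρ ^ (m + n)) ^ (q⁻¹).toReal ≤ mixedNorm q r f := by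
  have hμ := cylMeasure_cube m n hρ0.le (by linarith [Real.pi_gt_three])
  have hν : timeMeasure (Set.Icc t₀ (t₀ + τ)) = ENNReal.ofReal τ := by
    rw [timeMeasure_Icc ht₀ hτ, add_sub_cancel_left]
  rw [← hμ, ← hν]
  refine mul_measure_rpow_le_eLpNorm (measurableSet_Icc.prod measurableSet_Icc) ?_ hq
    fun z hz => ?_
  · rw [hμ]
    exact (ENNReal.ofReal_pos.mpr (by positivity)).ne'
  · rw [enorm_eq_self]
    refine mul_measure_rpow_le_eLpNorm measurableSet_Icc ?_ hr fun t ht => ?_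
    · rw [hν]
      exact (ENNReal.ofReal_pos.mpr hτ0).ne'
    · rw [← ofReal_norm]
      exact ENNReal.ofReal_le_ofReal (h z hz t ht)

/-- The focusing region gives a left side of order `N^(D - α - 2/r - D/q)`, and the dispersed data
give a right side of order `N^(m/2 + n/p)` up to logarithms. -/
theorem sobolev_exponent_ge {m n : ℕ} (hm : 1 ≤ m) (hn : 1 ≤ n) {p q r : ℝ≥0∞} {α : ℝ}
    (hq : 1 ≤ q) (hr : 1 ≤ r) (hα : 0 ≤ α) {C : ℝ≥0}
    (hC : ∀ f : Cyl m n → ℂ, IsCylSchwartz f → mixedNorm q r f ≤ C * sobolevNorm α p f) :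
    ((m : ℝ) + n) * (1 / 2 - (q⁻¹).toReal) + n * (1 / 2 - (p⁻¹).toReal) - 2 * (r⁻¹).toReal
      ≤ α := by
  obtain ⟨c, hc, δ, hδ0, hδ, hlow⟩ := exists_le_norm_schrodinger_focusWave hm hn hα
  set D : ℝ := (m : ℝ) + n with hD
  have hmR : (1 : ℝ) ≤ m := by exact_mod_cast hm
  set ip := (p⁻¹).toReal
  set iq := (q⁻¹).toReal
  set ir := (r⁻¹).toReal
  have hip : 0 ≤ ip := ENNReal.toReal_nonneg
  set E := eLpNorm (fun z : Cyl m n => gaussProfile n z.2) p (cylMeasure m n) with hE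
  have hEtop : E ≠ ∞ := eLpNorm_snd_ne_top m (gaussProfile n) p
  -- The logarithm in Weyl's bound costs an arbitrarily small power of `N`, which is removed by
  -- letting `ε` tend to `0`.
  suffices ∀ ε > 0, D - α - 2 * ir - D * iq ≤ m / 2 + n * ip + ε by
    have := le_of_forall_pos_le_add this
    have h2 : D - m / 2 = D / 2 + n / 2 := by rw [hD]; ring
    nlinarith
  intro ε hε
  -- Chosen so that `(N^(1+η))^(m/2) = N^(m/2+ε)`.
  set η : ℝ := 2 * ε / m with hη
  have hη0 : 0 < η := by positivity
  have hu : Filter.Tendsto (fun a : ℕ => ((4 * a + 1 : ℕ) : ℝ)) Filter.atTop Filter.atTop :=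
    tendsto_natCast_atTop_atTop.comp
      (Filter.tendsto_atTop_mono (fun a => by omega : ∀ a : ℕ, a ≤ 4 * a + 1) Filter.tendsto_id)
  refine le_of_eventually_mul_rpow_le hu (c := c * δ ^ ir * (δ ^ (m + n)) ^ iq)
    (C := C * (Real.sqrt (3 * (1 + 1 / η)) ^ m * 5 ^ n * E.toReal)) (by positivity) ?_
  filter_upwards [Filter.eventually_ge_atTop 1] with a ha
  obtain ⟨N, hN⟩ : ∃ N, N = 4 * a + 1 := ⟨_, rfl⟩
  rw [← hN]
  have hNa : (N : ℝ) = 4 * a + 1 := by rw [hN]; push_cast; ring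
  have haR : (1 : ℝ) ≤ a := by exact_mod_cast ha
  have hN1 : (1 : ℝ) ≤ N := by linarith
  set x : ℝ := (N : ℝ) with hx
  have hx0 : 0 < x := by linarith
  have hεN : 0 < (x ^ 2)⁻¹ := by positivity
  set t₀ : ℝ := Real.pi * a / N with ht₀
  -- Together with a window of length at most `1/10`, this keeps all the times used in `[0, 1]`.
  have ht₀1 : t₀ ≤ 4 / 5 := by
    rw [ht₀, div_le_iff₀ hx0, hNa]
    nlinarith [Real.pi_lt_d2]
  have hτ1 : δ / x ^ 2 ≤ 1 / 10 := by
    refine (div_le_self hδ0.le (by nlinarith)).trans hδ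
  have hρ1 : δ / x ≤ 1 := (div_le_self hδ0.le hN1).trans (by linarith)
  have h1 := le_mixedNorm (f := focusWave m n α t₀ N (x ^ 2)⁻¹ hεN) hq hr (ρ := δ / x)
    (τ := δ / x ^ 2) (t₀ := t₀) (c := c * x ^ (D - α)) (by positivity) hρ1 (by positivity)
    (by positivity) (by linarith) (fun z hz t ht =>
      hlow N (by omega) t₀ t hεN z ht.1 ht.2 (abs_le_of_mem_cube hz.1) (abs_le_of_mem_cube hz.2))
  have h2 := sobolevNorm_focusWave_le (m := m) (n := n) ha hN α p hεN
  rw [← hE] at h2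
  have h3 := (h1.trans (hC _ (isCylSchwartz_waveSum _ _))).trans (mul_le_mul_right h2 _)
  have h4 := ENNReal.toReal_mono (by
    refine ENNReal.mul_ne_top ENNReal.coe_ne_top (ENNReal.mul_ne_top ENNReal.ofReal_ne_top
      (ENNReal.mul_ne_top ?_ hEtop))
    exact ENNReal.rpow_ne_top_of_nonneg hip ENNReal.ofReal_ne_top) h3
  rw [ENNReal.toReal_mul, ENNReal.toReal_mul, ENNReal.toReal_mul, ENNReal.toReal_mul,
    ENNReal.toReal_mul, ← ENNReal.toReal_rpow, ← ENNReal.toReal_rpow, ← ENNReal.toReal_rpow,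
    ENNReal.toReal_ofReal (by positivity), ENNReal.toReal_ofReal (by positivity),
    ENNReal.toReal_ofReal (by positivity), ENNReal.toReal_ofReal (by positivity),
    ENNReal.toReal_ofReal (by positivity), ENNReal.coe_toReal] at h4
  have hL : c * x ^ (D - α) * (δ / x ^ 2) ^ ir * ((δ / x) ^ (m + n)) ^ iq =
      c * δ ^ ir * (δ ^ (m + n)) ^ iq * x ^ (D - α - 2 * ir - D * iq) := by
    have e1 : (x ^ 2) ^ ir = x ^ (2 * ir) := by
      rw [← Real.rpow_natCast, ← Real.rpow_mul hx0.le]; norm_num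
    have e2 : (x ^ (m + n)) ^ iq = x ^ (D * iq) := by
      rw [← Real.rpow_natCast, ← Real.rpow_mul hx0.le]; push_cast; rfl
    rw [div_pow, Real.div_rpow hδ0.le (by positivity), Real.div_rpow (by positivity)
      (by positivity), e1, e2, Real.rpow_sub hx0 (D - α - 2 * ir), Real.rpow_sub hx0 (D - α)]
    ring
  have hR1 : (x ^ n) ^ ip = x ^ (n * ip) := by
    rw [← Real.rpow_natCast, ← Real.rpow_mul hx0.le]
  have hlog : 3 * x * (1 + Real.log x) ≤ 3 * (1 + 1 / η) * x ^ (1 + η) := by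
    have e1 := Real.log_le_rpow_div hx0.le hη0
    have e2 : 1 ≤ x ^ η := Real.one_le_rpow hN1 hη0.le
    rw [Real.rpow_add hx0, Real.rpow_one]
    have : 1 + Real.log x ≤ (1 + 1 / η) * x ^ η := by
      rw [add_mul, one_mul, one_div, inv_mul_eq_div]; linarith
    nlinarith
  have hR2 : Real.sqrt (3 * x * (1 + Real.log x)) ^ m ≤
      Real.sqrt (3 * (1 + 1 / η)) ^ m * x ^ (m / 2 + ε) := by
    have e1 : x ^ ((m : ℝ) / 2 + ε) = Real.sqrt (x ^ (1 + η)) ^ m := by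
      rw [Real.sqrt_eq_rpow, ← Real.rpow_mul hx0.le, ← Real.rpow_natCast, ← Real.rpow_mul hx0.le]
      congr 1
      rw [hη]; field_simp
    rw [e1, ← mul_pow, ← Real.sqrt_mul (by positivity)]
    gcongr
  rw [hL, hR1] at h4
  refine h4.trans ?_
  have e3 : x ^ ((m : ℝ) / 2 + n * ip + ε) = x ^ ((m : ℝ) / 2 + ε) * x ^ (n * ip) := by
    rw [← Real.rpow_add hx0]; congr 1; ring
  rw [e3]
  calc _ ≤ C * (Real.sqrt (3 * (1 + 1 / η)) ^ m * x ^ ((m : ℝ) / 2 + ε) * 5 ^ n *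
        (x ^ (n * ip) * E.toReal)) := by gcongr
    _ = _ := by ring

theorem proposition1p3 (m n : ℕ) (hm : 1 ≤ m) (hn : 1 ≤ n) :
    (∀ (p q r : ℝ≥0∞) (α : ℝ), 1 ≤ p → 1 ≤ q → 1 ≤ r → 0 ≤ α →
      (∃ C : ℝ≥0, ∀ f : Cyl m n → ℂ, IsCylSchwartz f →
        mixedNorm q r f ≤ C * sobolevNorm α p f) →
      α ≥ ((m : ℝ) + n) * (1 / 2 - (q⁻¹).toReal) + n * (1 / 2 - (p⁻¹).toReal)
            - 2 * (r⁻¹).toReal ∧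
      (p = q → q = r →
        α ≥ ((m : ℝ) + 2 * n) * (1 / 2 - (p⁻¹).toReal) - 2 * (p⁻¹).toReal) ∧
      (p = 2 → q = r →
        α ≥ ((m : ℝ) + n) * (1 / 2 - (q⁻¹).toReal) - 2 * (q⁻¹).toReal)) ∧
    (∀ (σ : Cyl m n → ℝ), IsUnitCubePartition σ →
      ∀ (p q : ℝ≥0∞) (α : ℝ), 1 ≤ p → 1 ≤ q →
      (∃ C : ℝ≥0, ∀ f : Cyl m n → ℂ, IsCylSchwartz f →
        spaceTimeNorm p f ≤ C * modulationNorm σ α p q f) →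
      α ≥ max 0 (((m : ℝ) + n) * (1 - (p⁻¹).toReal - (q⁻¹).toReal) - 2 * (p⁻¹).toReal)) := by
  refine ⟨fun p q r α _ hq hr hα ⟨C, hC⟩ => ?_, fun σ hσ p q α hp _ ⟨C, hC⟩ => ?_⟩
  · have h := sobolev_exponent_ge hm hn hq hr hα hC
    refine ⟨h, ?_, ?_⟩
    · rintro rfl rfl
      linarith
    · rintro rfl rfl
      have h2 : ((2 : ℝ≥0∞)⁻¹).toReal = 1 / 2 := by simp
      rw [h2] at h
      linarith
  · have h0 := modulation_exponent_nonneg hm hn hσ hp hC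
    exact max_le h0 (modulation_exponent_ge hm hσ hp h0 hC)
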